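/- Adaptive data analysis with linear queries over a finite universe $\mathcal{X}$: there is an unknown distribution $\mathcal{D}$ over $\mathcal{X}$; a randomized interactive algorithm receives $n$ independent samples from $\mathcal{D}$ and then answers $m$ queries $f_1,\dots,f_m:\mathcal{X}\to[0,1]$, one after the other, with real numbers $a_1,\dots,a_m$, where $f_i$ is chosen by a (possibly randomized) adversary on the basis of $f_1,a_1,\dots,f_{i-1},a_{i-1}$. The algorithm is $(\alpha,\beta,m)$-accurate if for every distribution $\mathcal{D}$ and every adversary (which may depend on $\mathcal{D}$), with probability at least $1-\beta$ we have $|a_i-\mathbb{E}_{x\sim\mathcal{D}}[f_i(x)]|\le\alpha$ for all $i\in\{1,\dots,m\}$. **Theorem.** For every constant $\beta_0<1$ there is a constant $C>0$, depending only on $\beta_0$, such that the following holds. For every finite universe $\mathcal{X}$, every integer $m\ge1$, every $\alpha\in(0,1)$ and every $\beta$ with $2^{-m}\le\beta\le\beta_0$, there are an integer $n\ge 0$ with \[ n \le C\left(\min\left(\frac{\sqrt{\log|\mathcal{X}|\,\log(1/\beta)}}{\alpha^3},\ \frac{\log|\mathcal{X}|}{\alpha^4}\right)\log m+\frac{\log(1/\beta)}{\alpha^2}\right)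 \] and an $(\alpha,\beta,m)$-accurate adaptive data analysis algorithm for linear queries that uses $n$ samples. -/

import Mathlib

open scoped BigOperators

universe u

noncomputable section

namespace AdaptiveDataAnalysis

/-- A linear query over the universe `X`: a function `f : X → [0,1]`. -/
abbrev LinearQuery (X : Type u) : Type u := X → Set.Icc (0 : ℝ) 1

/-- The population value `𝔼_{x ∼ D} [f x]` of a linear query. -/
def populationValue {X : Type u} [Fintype X] (D : PMF X) (f : LinearQuery X) : ℝ :=
  ∑ x, (D x).toReal * (f x : ℝ)

/-- The distribution `D^n` of `n` independent samples from `D`. -/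
def iidSample {X : Type u} [Fintype X] (n : ℕ) (D : PMF X) : PMF (Fin n → X) :=
  PMF.ofFintype (fun S => ∏ i, D (S i)) (by
    classical
    have h := Finset.prod_univ_sum (fun _ : Fin n => (Finset.univ : Finset X))
      (fun _ x => D x)
    rw [Fintype.piFinset_univ] at h
    rw [← h]
    have hD : ∑ x, D x = 1 := by
      rw [← tsum_fintype (L := SummationFilter.unconditional X)]
      exact D.tsum_coe
    simp [hD])

/-- The record of the interaction so far: the queries asked and the answers given, in order. -/
abbrev Transcript (X : Type u) : Type u := List (LinearQuery X × ℝ)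

/-- A randomized, stateful, interactive algorithm with `n` samples.  It sets up its internal state
from the samples; upon each query it then updates the state at random and outputs a real number.
It has no access to the underlying distribution or to future queries. -/
structure Algorithm (X : Type u) (n : ℕ) where
  /-- The internal states. -/
  State : Type u
  /-- The initial state, computed from the samples. -/
  init : (Fin n → X) → PMF State
  /-- Processing one query: the new state and the answer. -/
  step : State → LinearQuery X → PMF (State × ℝ)

/-- A (randomized) adaptive adversary: it chooses the next query from all previous queries
and answers. -/
abbrev Adversary (X : Type u) : Type u := Transcript X → PMF (LinearQuery X)

/-- The law of the transcript after `k` further rounds of interaction, started with the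
internal state `s` and the transcript `h`. -/
def interact {X : Type u} {n : ℕ} (A : Algorithm X n) (B : Adversary X) :
    ℕ → A.State → Transcript X → PMF (Transcript X)
  | 0, _, h => PMF.pure h
  | k + 1, s, h =>
      (B h).bind fun f =>
        (A.step s f).bind fun r => interact A B k r.1 (h ++ [(f, r.2)])

/-- The law of the transcript of the whole experiment: draw `S ∼ D^n`, hand it to the
algorithm, and let it answer `m` queries of the adversary. -/
def experiment {X : Type u} [Fintype X] {n : ℕ} (A : Algorithm X n) (B : Adversary X)
    (D : PMF X) (m : ℕ) : PMF (Transcript X) :=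
  (iidSample n D).bind fun S => (A.init S).bind fun s => interact A B m s []

/-- The event that all answers are within additive error `α` of the population values. -/
def accurateTranscripts {X : Type u} [Fintype X] (D : PMF X) (α : ℝ) : Set (Transcript X) :=
  {h | ∀ p ∈ h, |p.2 - populationValue D p.1| ≤ α}

/-- `(α, β, m)`-accuracy: for every distribution and every adaptive adversary (which may depend
on the distribution), with probability at least `1 - β` all `m` answers have error at most `α`. -/
def IsAccurate {X : Type u} [Fintype X] {n : ℕ} (A : Algorithm X n) (α β : ℝ) (m : ℕ) : Prop :=
  ∀ (D : PMF X) (B : Adversary X),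
    1 - β ≤ ((experiment A B D m).toOuterMeasure (accurateTranscripts D α)).toReal

end AdaptiveDataAnalysis

end

/-!
The algorithm is private multiplicative weights. Its state is the sample `S` and a hypothesis, a
distribution on `X` given by log-weights. On a query it either answers with the value `h` of the
hypothesis, or releases a grid value close to the empirical mean `y` and tilts the hypothesis
towards it. The outcome is drawn from a kernel supported on good outcomes (`IsGoodOutcome`), so
with certainty every answer has error at most `α / 2` on the sample, and every update happens at a
margin. By the potential argument for multiplicative weights there are therefore, again with
certainty, at most `T ≈ log |X| / α ^ 2` updates (`updateCount_mul_le_potential`). It remains to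
bound the probability that some query has an empirical mean far from its true mean.

A kernel with such deterministic guarantees cannot be purely differentially private, but it is
dominated by one that is: up to a factor `1 + 1 / m` per query (in total at most `e`), it lies
below a positive kernel `P` which changes little if one sample is exchanged, and probabilities of
bad events may be bounded under `P`. For `P`, the outcome `none` is free of charge: the likelihood
ratio of neighbouring samples, discounted by a constant factor per update, has `p`-th moment at
most one (`sum_mul_ratio_pow_le_one`, `sum_pathProd_ratio_discounted_le`), so restricted to at
most `T` updates its moments are controlled by `T` and not by `m`. Such a moment bound of order `p
≈ log (1 / β) / α` implies generalization (`tail_le_of_moments`): if `Z` is the excess of the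
empirical over the true mean of the selected query and `Ψ` a truncated exponential of `Z`, then
`𝔼[Z Ψ]` is small compared to `𝔼[Ψ]`, since the empirical mean is an average over `n` entries,
each of which may be replaced by a fresh one at the cost of a likelihood ratio. As answers are
accurate on the sample, a violated answer exhibits, as a function of the transcript alone, a query
with `Z ≥ α / 2`; so there is no union bound over the queries.

With `B` a multiple of `log (1 / β)`, there are two regimes. If `B ≤ T`, then `P` is an
exponential mechanism with a bias towards `none`, and a sample of size of order `√(B T) log m / α
^ 2 + B / α ^ 2` suffices. If `T < B`, the outcome is chosen deterministically, `P` ignores the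
sample, and the domination costs an additional factor polynomial in `m` per update; this is a
description-length argument, with sample size of order `(T log m + B) / α ^ 2`. For `m = 1`, where
`log m = 0`, empirical means are used. Randomized adversaries are reduced to deterministic query
trees by averaging (`exists_queryTree_le`).
-/

noncomputable section

namespace AdaptiveDataAnalysis

/-! ### Stability implies generalization -/

/-- The empirical mean of `g` over the sample `S`. -/
def sampleMean {X : Type*} {n : ℕ} (S : Fin n → X) (g : X → ℝ) : ℝ := (∑ i, g (S i)) / n

/-- The mean of `g` with respect to the weights `d`. -/
def weightedMean {X : Type*} [Fintype X] (d : X → ℝ) (g : X → ℝ) : ℝ := ∑ x, d x * g x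

/-- The probability of the sample `S` under `n` independent draws with weights `d`. -/
def sampleWeight {X : Type*} {n : ℕ} (d : X → ℝ) (S : Fin n → X) : ℝ := ∏ i, d (S i)

lemma sampleWeight_nonneg {X : Type*} {n : ℕ} {d : X → ℝ} (hd : ∀ x, 0 ≤ d x) (S : Fin n → X) :
    0 ≤ sampleWeight d S := Finset.prod_nonneg fun _ _ => hd _

lemma sum_sampleWeight {X : Type*} [Fintype X] {d : X → ℝ} (hd1 : ∑ x, d x = 1) (n : ℕ) :
    ∑ S : Fin n → X, sampleWeight d S = 1 := by
  classical
  have h := Finset.prod_univ_sum (fun _ : Fin n => (Finset.univ : Finset X)) (fun _ x => d x)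
  rw [Fintype.piFinset_univ] at h
  simp only [sampleWeight]
  rw [← h]
  simp [hd1]

lemma sampleWeight_update {X : Type*} {n : ℕ} (d : X → ℝ) (S : Fin n → X) (j : Fin n) (y : X) :
    sampleWeight d (Function.update S j y) * d (S j) = sampleWeight d S * d y := by
  classical
  unfold sampleWeight
  rw [← Finset.mul_prod_erase _ _ (Finset.mem_univ j),
    ← Finset.mul_prod_erase _ (fun i => d (S i)) (Finset.mem_univ j)]
  have : ∏ x ∈ Finset.univ.erase j, d (Function.update S j y x)
      = ∏ x ∈ Finset.univ.erase j, d (S x) := by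
    refine Finset.prod_congr rfl fun i hi => ?_
    rw [Function.update_of_ne (Finset.ne_of_mem_erase hi)]
  rw [this, Function.update_self]
  ring

/-- Exchanging the `j`-th sample with a fresh one does not change the joint law. -/
lemma sum_sampleWeight_resample {X : Type*} [Fintype X] {n : ℕ} {d : X → ℝ}
    (hd1 : ∑ x, d x = 1) (j : Fin n) (F : (Fin n → X) → X → ℝ) :
    ∑ S, sampleWeight d S * F S (S j)
      = ∑ S, sampleWeight d S * ∑ y, d y * F (Function.update S j y) y := by
  classical
  have h1 : ∑ S, sampleWeight d S * F S (S j)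
      = ∑ z : (Fin n → X) × X, sampleWeight d z.1 * d z.2 * F z.1 (z.1 j) := by
    rw [Fintype.sum_prod_type]
    refine Finset.sum_congr rfl fun S _ => ?_
    have : ∀ y, sampleWeight d S * d y * F S (S j) = d y * (sampleWeight d S * F S (S j)) :=
      fun y => by ring
    simp only [this]
    rw [← Finset.sum_mul, hd1, one_mul]
  have h2 : ∑ S, sampleWeight d S * ∑ y, d y * F (Function.update S j y) y
      = ∑ z : (Fin n → X) × X,
          sampleWeight d z.1 * d z.2 * F (Function.update z.1 j z.2) z.2 := by
    rw [Fintype.sum_prod_type]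
    refine Finset.sum_congr rfl fun S _ => ?_
    rw [Finset.mul_sum]
    exact Finset.sum_congr rfl fun y _ => by ring
  rw [h1, h2]
  let e : (Fin n → X) × X → (Fin n → X) × X := fun z => (Function.update z.1 j z.2, z.1 j)
  have he : Function.Involutive e := by
    rintro ⟨S, y⟩
    simp [e]
  refine Fintype.sum_bijective e he.bijective _ _ ?_
  rintro ⟨S, y⟩
  simp only [e, Function.update_idem, Function.update_eq_self, sampleWeight_update]

/-- A tangent-line form of Markov's inequality: beyond `1 + a`, the excess of `t` is dominated
by a small multiple of `t ^ p`. -/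
lemma le_one_add_add_pow {a t : ℝ} (ha : 0 ≤ a) (ht : 0 ≤ t) {p : ℕ} (hp : 1 ≤ p) :
    t ≤ 1 + a + (1 + a) / (p * (1 + a) ^ p) * t ^ p := by
  have ha1 : 0 < 1 + a := by linarith
  have hp0 : (0 : ℝ) < p := by exact_mod_cast hp
  set r := t / (1 + a) with hr
  have hr0 : 0 ≤ r := by positivity
  have htr : t = (1 + a) * r := by rw [hr]; field_simp
  have hb : 1 + (p : ℝ) * (r - 1) ≤ r ^ p := by
    have := one_add_mul_le_pow (a := r - 1) (by linarith) p
    simpa using this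
  have h3 : r ≤ 1 + r ^ p / p := by
    rw [← sub_le_iff_le_add', le_div_iff₀ hp0]
    linarith
  have : (1 + a) / (p * (1 + a) ^ p) * t ^ p = (1 + a) * (r ^ p / p) := by
    rw [htr, mul_pow]; field_simp
  rw [this, htr]
  nlinarith

/-- The tilting weight `exp (-θ (τ - z)⁺)`. -/
def tilt (θ τ z : ℝ) : ℝ := Real.exp (-θ * max (τ - z) 0)

lemma tilt_pos (θ τ z : ℝ) : 0 < tilt θ τ z := Real.exp_pos _

lemma tilt_le_one {θ : ℝ} (hθ : 0 ≤ θ) (τ z : ℝ) : tilt θ τ z ≤ 1 := by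
  unfold tilt
  rw [Real.exp_le_one_iff]
  have := le_max_right (τ - z) 0
  nlinarith

lemma tilt_eq_one (θ : ℝ) {τ z : ℝ} (h : τ ≤ z) : tilt θ τ z = 1 := by
  simp [tilt, max_eq_right (sub_nonpos.2 h)]

lemma tilt_le_exp_mul {θ τ z z' r : ℝ} (hθ : 0 ≤ θ) (h : z' ≤ z + r) (hr : 0 ≤ r) :
    tilt θ τ z' ≤ Real.exp (θ * r) * tilt θ τ z := by
  unfold tilt
  rw [← Real.exp_add, Real.exp_le_exp]
  have : max (τ - z) 0 ≤ max (τ - z') 0 + r := by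
    refine max_le ?_ ?_
    · have := le_max_left (τ - z') 0; linarith
    · have := le_max_right (τ - z') 0; linarith
  nlinarith

lemma mul_tilt_ge {θ τ : ℝ} (hθ : 0 < θ) (hτ : 0 ≤ τ) (z : ℝ) :
    τ / 2 * tilt θ τ z - Real.exp (-(θ * τ / 2)) / θ ≤ z * tilt θ τ z := by
  have hp : 0 ≤ Real.exp (-(θ * τ / 2)) / θ := by positivity
  have ht := tilt_pos θ τ z
  rcases le_total (τ / 2) z with h | h
  · nlinarith
  · set v := τ / 2 - z with hv
    have hv0 : 0 ≤ v := by linarith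
    have hz : max (τ - z) 0 = τ / 2 + v := by
      rw [max_eq_left (by linarith)]; linarith
    have h1 : tilt θ τ z = Real.exp (-(θ * τ / 2)) * Real.exp (-(θ * v)) := by
      unfold tilt; rw [hz, ← Real.exp_add]; congr 1; ring
    have h2 : v * Real.exp (-(θ * v)) ≤ 1 / θ := by
      rw [Real.exp_neg, ← div_eq_mul_inv, div_le_div_iff₀ (Real.exp_pos _) hθ]
      have := Real.add_one_le_exp (θ * v)
      linarith
    have h3 : v * tilt θ τ z ≤ Real.exp (-(θ * τ / 2)) / θ := by
      rw [h1]
      have := mul_le_mul_of_nonneg_left h2 (Real.exp_pos (-(θ * τ / 2))).le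
      calc _ = Real.exp (-(θ * τ / 2)) * (v * Real.exp (-(θ * v))) := by ring
        _ ≤ _ := this
        _ = _ := by ring
    have : z * tilt θ τ z = τ / 2 * tilt θ τ z - v * tilt θ τ z := by rw [hv]; ring
    linarith

lemma weightedMean_le_one {X : Type*} [Fintype X] {d g : X → ℝ} (hd : ∀ x, 0 ≤ d x)
    (hd1 : ∑ x, d x = 1) (hg : ∀ x, g x ≤ 1) : weightedMean d g ≤ 1 := by
  rw [← hd1]
  exact Finset.sum_le_sum fun x _ => by nlinarith [hd x, hg x]

/-- Replacing one of `n` samples moves the empirical mean of a `[0,1]`-valued function by at most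
`1 / n`. -/
lemma abs_sampleMean_update_sub_le {X : Type*} {n : ℕ} (S : Fin n → X) (j : Fin n) (y : X)
    {g : X → ℝ} (h0 : ∀ x, 0 ≤ g x) (h1 : ∀ x, g x ≤ 1) :
    |sampleMean (Function.update S j y) g - sampleMean S g| ≤ 1 / n := by
  classical
  have hn : (0 : ℝ) < n := by exact_mod_cast (Fin.pos j)
  unfold sampleMean
  rw [← Finset.add_sum_erase _ _ (Finset.mem_univ j),
    ← Finset.add_sum_erase _ (fun i => g (S i)) (Finset.mem_univ j)]
  have : ∑ x ∈ Finset.univ.erase j, g (Function.update S j y x)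
      = ∑ x ∈ Finset.univ.erase j, g (S x) := by
    refine Finset.sum_congr rfl fun i hi => ?_
    rw [Function.update_of_ne (Finset.ne_of_mem_erase hi)]
  rw [this, Function.update_self, ← sub_div, add_sub_add_right_eq_sub, abs_div, abs_of_pos hn]
  gcongr
  rw [abs_le]
  constructor <;> linarith [h0 y, h1 y, h0 (S j), h1 (S j)]

/-- One resampling step of the stability argument: exchanging a sample multiplies the tilted
likelihood by at most `1 + a`, up to an error controlled by the moments of the likelihood
ratio. -/
lemma resample_tilted_le {X O : Type*} [Fintype X] {n : ℕ} {d : X → ℝ}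
    (hd : ∀ x, 0 ≤ d x) (hd1 : ∑ x, d x = 1) (s : Finset O) (L : (Fin n → X) → O → ℝ)
    (hL : ∀ S o, 0 < L S o) (φ : O → X → ℝ) (hφ0 : ∀ o x, 0 ≤ φ o x) (hφ1 : ∀ o x, φ o x ≤ 1)
    {p : ℕ} (hp : 1 ≤ p) {M : ℝ}
    (hM : ∀ S j y, ∑ o ∈ s, L S o * (L (Function.update S j y) o / L S o) ^ p ≤ M)
    {a θ τ : ℝ} (ha : 0 ≤ a) (hθ : 0 ≤ θ) (j : Fin n) :
    ∑ S, sampleWeight d S * ∑ o ∈ s, L S o *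
        tilt θ τ (sampleMean S (φ o) - weightedMean d (φ o)) * φ o (S j)
      ≤ (1 + a) * ∑ S, sampleWeight d S * ∑ o ∈ s, L S o *
          tilt θ τ (sampleMean S (φ o) - weightedMean d (φ o)) * weightedMean d (φ o)
        + (1 + a) / (p * (1 + a) ^ p) * (Real.exp (p * (θ / n)) * M) := by
  classical
  set Z : (Fin n → X) → O → ℝ := fun S o => sampleMean S (φ o) - weightedMean d (φ o) with hZ
  set ζ := (1 + a) / (p * (1 + a) ^ p) with hζ
  have hζ0 : 0 ≤ ζ := by positivity
  have hM0 : ∀ S : Fin n → X, 0 ≤ sampleWeight d S := sampleWeight_nonneg hd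
  have key : ∀ S y o, L (Function.update S j y) o * tilt θ τ (Z (Function.update S j y) o)
      ≤ (1 + a) * (L S o * tilt θ τ (Z S o))
        + ζ * (Real.exp (p * (θ / n)) * (L S o * (L (Function.update S j y) o / L S o) ^ p)) := by
    intro S y o
    have hLS := hL S o
    have ht := tilt_pos θ τ (Z S o)
    have ht1 := tilt_le_one hθ τ (Z S o)
    set ρ := L (Function.update S j y) o / L S o with hρ
    have hρ0 : 0 < ρ := div_pos (hL _ _) hLS
    have h1 : tilt θ τ (Z (Function.update S j y) o)
        ≤ Real.exp (θ * (1 / n)) * tilt θ τ (Z S o) := by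
      refine tilt_le_exp_mul hθ ?_ (by positivity)
      have := (abs_le.1 (abs_sampleMean_update_sub_le S j y (hφ0 o) (hφ1 o))).2
      simp only [hZ]; linarith
    have h2 := le_one_add_add_pow ha (t := ρ * Real.exp (θ * (1 / n))) (by positivity) hp
    rw [← hζ] at h2
    have h3 : (ρ * Real.exp (θ * (1 / n))) ^ p = Real.exp (p * (θ / n)) * ρ ^ p := by
      rw [mul_pow, ← Real.exp_nat_mul]; ring_nf
    rw [h3] at h2
    have h4 : L (Function.update S j y) o = L S o * ρ := by rw [hρ]; field_simp
    rw [h4]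
    calc L S o * ρ * tilt θ τ (Z (Function.update S j y) o)
        ≤ L S o * ρ * (Real.exp (θ * (1 / n)) * tilt θ τ (Z S o)) := by gcongr
      _ = (ρ * Real.exp (θ * (1 / n))) * (L S o * tilt θ τ (Z S o)) := by ring
      _ ≤ (1 + a + ζ * (Real.exp (p * (θ / n)) * ρ ^ p)) * (L S o * tilt θ τ (Z S o)) := by
          gcongr
      _ = (1 + a) * (L S o * tilt θ τ (Z S o))
          + ζ * (Real.exp (p * (θ / n)) * (L S o * ρ ^ p)) * tilt θ τ (Z S o) := by ring
      _ ≤ _ := by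
          have : 0 ≤ ζ * (Real.exp (p * (θ / n)) * (L S o * ρ ^ p)) := by positivity
          nlinarith
  have hres := sum_sampleWeight_resample hd1 j
    (fun S x => ∑ o ∈ s, L S o * tilt θ τ (Z S o) * φ o x)
  rw [hres]
  have step : ∀ S : Fin n → X, ∑ y, d y * ∑ o ∈ s, L (Function.update S j y) o *
        tilt θ τ (Z (Function.update S j y) o) * φ o y
      ≤ (1 + a) * ∑ o ∈ s, L S o * tilt θ τ (Z S o) * weightedMean d (φ o)
        + ζ * (Real.exp (p * (θ / n)) * M) := by
    intro S
    have h1 : ∀ y, d y * ∑ o ∈ s, L (Function.update S j y) o *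
        tilt θ τ (Z (Function.update S j y) o) * φ o y
        ≤ (1 + a) * (∑ o ∈ s, L S o * tilt θ τ (Z S o) * (d y * φ o y))
          + d y * (ζ * (Real.exp (p * (θ / n)) * M)) := by
      intro y
      have : ∑ o ∈ s, L (Function.update S j y) o *
          tilt θ τ (Z (Function.update S j y) o) * φ o y
          ≤ ∑ o ∈ s, ((1 + a) * (L S o * tilt θ τ (Z S o) * φ o y)
            + ζ * (Real.exp (p * (θ / n)) *
              (L S o * (L (Function.update S j y) o / L S o) ^ p))) := by
        refine Finset.sum_le_sum fun o _ => ?_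
        have hk := mul_le_mul_of_nonneg_right (key S y o) (hφ0 o y)
        have hnn : 0 ≤ ζ * (Real.exp (p * (θ / n)) *
            (L S o * (L (Function.update S j y) o / L S o) ^ p)) := by
          have := hL S o
          have := hL (Function.update S j y) o
          positivity
        nlinarith [hφ1 o y]
      rw [Finset.sum_add_distrib, ← Finset.mul_sum, ← Finset.mul_sum, ← Finset.mul_sum] at this
      have h5 : ζ * (Real.exp (p * (θ / n)) *
          ∑ o ∈ s, L S o * (L (Function.update S j y) o / L S o) ^ p)
          ≤ ζ * (Real.exp (p * (θ / n)) * M) := by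
        gcongr; exact hM S j y
      have h6 := mul_le_mul_of_nonneg_left (this.trans (add_le_add_right h5 _)) (hd y)
      refine h6.trans (le_of_eq ?_)
      rw [mul_add]
      congr 1
      rw [Finset.mul_sum, Finset.mul_sum, Finset.mul_sum]
      exact Finset.sum_congr rfl fun o _ => by ring
    refine (Finset.sum_le_sum fun y _ => h1 y).trans (le_of_eq ?_)
    rw [Finset.sum_add_distrib, ← Finset.sum_mul, hd1, one_mul, ← Finset.mul_sum]
    congr 2
    rw [Finset.sum_comm]
    refine Finset.sum_congr rfl fun o _ => ?_
    rw [weightedMean, Finset.mul_sum]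
  refine (Finset.sum_le_sum fun S _ => mul_le_mul_of_nonneg_left (step S) (hM0 S)).trans
    (le_of_eq ?_)
  simp only [mul_add]
  rw [Finset.sum_add_distrib, ← Finset.sum_mul, sum_sampleWeight hd1, one_mul, Finset.mul_sum]
  congr 1
  exact Finset.sum_congr rfl fun S _ => by ring

/-- **Generalization from stability of order `p`.**  If exchanging one sample changes the
likelihood of the outcome so little that the `p`-th moment of the likelihood ratio stays below `M`,
then the empirical mean of a `[0,1]`-valued function selected by the outcome exceeds its true
mean by `τ` only with small probability. -/
lemma tail_le_of_moments {X O : Type*} [Fintype X] {n : ℕ} {d : X → ℝ}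
    (hd : ∀ x, 0 ≤ d x) (hd1 : ∑ x, d x = 1) (s : Finset O) (L : (Fin n → X) → O → ℝ)
    (hL : ∀ S o, 0 < L S o) (hL1 : ∀ S, ∑ o ∈ s, L S o ≤ 1)
    (φ : O → X → ℝ) (hφ0 : ∀ o x, 0 ≤ φ o x) (hφ1 : ∀ o x, φ o x ≤ 1)
    {p : ℕ} (hp : 1 ≤ p) {M : ℝ}
    (hM : ∀ S j y, ∑ o ∈ s, L S o * (L (Function.update S j y) o / L S o) ^ p ≤ M)
    {θ τ : ℝ} (hθ : 0 < θ) (hτ : 0 < τ) (hn : 0 < n) :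
    ∑ S, sampleWeight d S * ∑ o ∈ s,
        (if τ ≤ sampleMean S (φ o) - weightedMean d (φ o) then L S o else 0)
      ≤ 4 / τ * ((1 + τ / 4) / (p * (1 + τ / 4) ^ p) * (Real.exp (p * (θ / n)) * M)
        + Real.exp (-(θ * τ / 2)) / θ) := by
  classical
  set Z : (Fin n → X) → O → ℝ := fun S o => sampleMean S (φ o) - weightedMean d (φ o) with hZ
  set V := ∑ S, sampleWeight d S * ∑ o ∈ s, L S o * tilt θ τ (Z S o) with hV
  set A := ∑ S, sampleWeight d S * ∑ o ∈ s, L S o * tilt θ τ (Z S o) * weightedMean d (φ o)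
    with hA
  set err := (1 + τ / 4) / (p * (1 + τ / 4) ^ p) * (Real.exp (p * (θ / n)) * M) with herr
  set err2 := Real.exp (-(θ * τ / 2)) / θ with herr2
  have hn' : (0 : ℝ) < n := by exact_mod_cast hn
  have hw : ∀ S : Fin n → X, 0 ≤ sampleWeight d S := sampleWeight_nonneg hd
  have hD1 : ∀ o, weightedMean d (φ o) ≤ 1 := fun o => weightedMean_le_one hd hd1 (hφ1 o)
  -- the empirical mean is the average of the `n` samples, each of which can be exchanged
  have h1 : ∑ S, sampleWeight d S * ∑ o ∈ s, L S o * tilt θ τ (Z S o) * sampleMean S (φ o)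
      ≤ (1 + τ / 4) * A + err := by
    have e1 : ∑ S, sampleWeight d S * ∑ o ∈ s, L S o * tilt θ τ (Z S o) * sampleMean S (φ o)
        = (∑ j : Fin n, ∑ S, sampleWeight d S * ∑ o ∈ s,
            L S o * tilt θ τ (Z S o) * φ o (S j)) / n := by
      rw [Finset.sum_comm, Finset.sum_div]
      refine Finset.sum_congr rfl fun S _ => ?_
      rw [← Finset.mul_sum, mul_div_assoc, Finset.sum_comm, Finset.sum_div]
      congr 1
      refine Finset.sum_congr rfl fun o _ => ?_
      rw [← Finset.mul_sum, mul_div_assoc, sampleMean]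
    rw [e1, div_le_iff₀ hn']
    refine (Finset.sum_le_sum fun j _ => resample_tilted_le hd hd1 s L hL φ hφ0 hφ1 hp hM
      (a := τ / 4) (τ := τ) (by positivity) hθ.le j).trans (le_of_eq ?_)
    rw [Finset.sum_const, Finset.card_univ, Fintype.card_fin, nsmul_eq_mul, mul_comm]
  have hAV : A ≤ V := by
    refine Finset.sum_le_sum fun S _ => mul_le_mul_of_nonneg_left ?_ (hw S)
    refine Finset.sum_le_sum fun o _ => ?_
    have : 0 ≤ L S o * tilt θ τ (Z S o) := (mul_pos (hL S o) (tilt_pos _ _ _)).le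
    nlinarith [hD1 o]
  have h2 : τ / 2 * V - err2
      ≤ ∑ S, sampleWeight d S * ∑ o ∈ s, L S o * tilt θ τ (Z S o) * sampleMean S (φ o) - A := by
    have e2 : ∑ S, sampleWeight d S * ∑ o ∈ s, L S o * tilt θ τ (Z S o) * sampleMean S (φ o) - A
        = ∑ S, sampleWeight d S * ∑ o ∈ s, L S o * (Z S o * tilt θ τ (Z S o)) := by
      rw [hA, ← Finset.sum_sub_distrib]
      refine Finset.sum_congr rfl fun S _ => ?_
      rw [← mul_sub, ← Finset.sum_sub_distrib]
      congr 1
      exact Finset.sum_congr rfl fun o _ => by simp only [hZ]; ring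
    rw [e2]
    have e3 : τ / 2 * V - err2 = ∑ S, sampleWeight d S *
        (τ / 2 * (∑ o ∈ s, L S o * tilt θ τ (Z S o)) - err2) := by
      simp only [mul_sub]
      rw [Finset.sum_sub_distrib, ← Finset.sum_mul, sum_sampleWeight hd1, one_mul, hV,
        Finset.mul_sum]
      congr 1
      exact Finset.sum_congr rfl fun S _ => by ring
    rw [e3]
    refine Finset.sum_le_sum fun S _ => mul_le_mul_of_nonneg_left ?_ (hw S)
    have herr2' : 0 ≤ err2 := by positivity
    calc τ / 2 * (∑ o ∈ s, L S o * tilt θ τ (Z S o)) - err2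
        ≤ τ / 2 * (∑ o ∈ s, L S o * tilt θ τ (Z S o)) - (∑ o ∈ s, L S o) * err2 := by
          nlinarith [hL1 S]
      _ = ∑ o ∈ s, L S o * (τ / 2 * tilt θ τ (Z S o) - err2) := by
          rw [Finset.mul_sum, Finset.sum_mul, ← Finset.sum_sub_distrib]
          exact Finset.sum_congr rfl fun o _ => by ring
      _ ≤ _ := Finset.sum_le_sum fun o _ =>
          mul_le_mul_of_nonneg_left (mul_tilt_ge hθ hτ.le _) (hL S o).le
  have h3 : V ≤ 4 / τ * (err + err2) := by
    rw [div_mul_eq_mul_div, le_div_iff₀ hτ]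
    nlinarith
  refine le_trans ?_ h3
  refine Finset.sum_le_sum fun S _ => mul_le_mul_of_nonneg_left ?_ (hw S)
  refine Finset.sum_le_sum fun o _ => ?_
  split_ifs with h
  · rw [tilt_eq_one θ h, mul_one]
  · exact (mul_pos (hL S o) (tilt_pos _ _ _)).le

/-- The parameters of `tail_le_of_moments` balanced for failure probability `2 exp (-2 B)`. -/
lemma tail_le_two_mul_exp {X O : Type*} [Fintype X] {n : ℕ} {d : X → ℝ}
    (hd : ∀ x, 0 ≤ d x) (hd1 : ∑ x, d x = 1) (s : Finset O) (L : (Fin n → X) → O → ℝ)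
    (hL : ∀ S o, 0 < L S o) (hL1 : ∀ S, ∑ o ∈ s, L S o ≤ 1)
    (φ : O → X → ℝ) (hφ0 : ∀ o x, 0 ≤ φ o x) (hφ1 : ∀ o x, φ o x ≤ 1)
    {p : ℕ} {B τ : ℝ} (hB : 1 ≤ B) (hτ : 0 < τ) (hτ1 : τ ≤ 1)
    (hp1 : 32 * B / τ ≤ p) (hp2 : (p : ℝ) ≤ 33 * B / τ) (hn : 132 * B / τ ^ 2 ≤ n)
    (hM : ∀ S j y, ∑ o ∈ s, L S o * (L (Function.update S j y) o / L S o) ^ p ≤ Real.exp B) :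
    ∑ S, sampleWeight d S * ∑ o ∈ s,
        (if τ ≤ sampleMean S (φ o) - weightedMean d (φ o) then L S o else 0)
      ≤ 2 * Real.exp (-(2 * B)) := by
  have hp32 : 32 * B ≤ p * τ := by rwa [div_le_iff₀ hτ] at hp1
  have hp33 : p * τ ≤ 33 * B := by rwa [le_div_iff₀ hτ] at hp2
  have hpr : (0 : ℝ) < p := lt_of_lt_of_le (by positivity) hp1
  have hp0 : 1 ≤ p := by exact_mod_cast hpr
  have hn' : (0 : ℝ) < n := lt_of_lt_of_le (by positivity) hn
  have hn0 : 0 < n := by exact_mod_cast hn'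
  have hnτ : 132 * B ≤ n * τ ^ 2 := by rwa [div_le_iff₀ (by positivity)] at hn
  have hmain := tail_le_of_moments hd hd1 s L hL hL1 φ hφ0 hφ1 hp0 hM
    (θ := 4 * B / τ) (τ := τ) (by positivity) hτ hn0
  refine hmain.trans ?_
  have h1 : Real.exp (4 * B) ≤ (1 + τ / 4) ^ p := by
    have h11 : Real.exp (τ / 8) ≤ 1 + τ / 4 := by
      have hx := Real.abs_exp_sub_one_le (x := τ / 8) (by rw [abs_of_pos (by positivity)]; linarith)
      rw [abs_of_pos (a := τ / 8) (by positivity)] at hx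
      linarith [(abs_le.1 hx).2]
    calc Real.exp (4 * B) ≤ Real.exp (p * (τ / 8)) := by
          rw [Real.exp_le_exp]; nlinarith
      _ = Real.exp (τ / 8) ^ p := by rw [Real.exp_nat_mul]
      _ ≤ _ := by gcongr
  have h2 : (p : ℝ) * (4 * B / τ / n) ≤ B := by
    rw [div_div, mul_div_assoc', div_le_iff₀ (by positivity)]
    have : p * 4 ≤ τ * n := by
      have : (p * 4) * τ ≤ (τ * n) * τ := by nlinarith
      exact le_of_mul_le_mul_right this hτ
    nlinarith
  have h3 : (1 + τ / 4) / (p * (1 + τ / 4) ^ p) * (Real.exp (p * (4 * B / τ / n)) * Real.exp B)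
      ≤ 2 / p * Real.exp (-(2 * B)) := by
    have e1 : Real.exp (p * (4 * B / τ / n)) * Real.exp B ≤ Real.exp (2 * B) := by
      rw [← Real.exp_add, Real.exp_le_exp]; linarith
    have e2 : Real.exp (-(2 * B)) = Real.exp (2 * B) / Real.exp (4 * B) := by
      rw [← Real.exp_sub]; congr 1; ring
    calc _ ≤ 2 / (p * Real.exp (4 * B)) * Real.exp (2 * B) := by
          gcongr
          linarith
      _ = _ := by rw [e2]; field_simp
  have h4 : -(4 * B / τ * τ / 2) = -(2 * B) := by field_simp; ring
  rw [h4]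
  have hE := Real.exp_pos (-(2 * B))
  calc 4 / τ * (_ + Real.exp (-(2 * B)) / (4 * B / τ))
      ≤ 4 / τ * (2 / p * Real.exp (-(2 * B)) + Real.exp (-(2 * B)) / (4 * B / τ)) := by gcongr
    _ = (8 / (p * τ) + 1 / B) * Real.exp (-(2 * B)) := by field_simp; ring
    _ ≤ 2 * Real.exp (-(2 * B)) := by
        gcongr
        have a1 : 8 / (p * τ) ≤ 1 := by rw [div_le_one (by positivity)]; linarith
        have a2 : 1 / B ≤ 1 := by rw [div_le_one (by positivity)]; linarith
        linarith

/-! ### Adaptive composition -/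

/-- The possible reactions to a query: `none` keeps the current hypothesis, `some i` releases the
grid value `i / J` and triggers an update of the hypothesis. -/
abbrev Outcome (J : ℕ) : Type := Option (Fin (J + 1))

/-- All outcome sequences of length `k`. -/
def paths (J : ℕ) : ℕ → Finset (List (Outcome J))
  | 0 => {[]}
  | k + 1 => (Finset.univ ×ˢ paths J k).image fun z => z.1 :: z.2

lemma sum_paths_zero {J : ℕ} {R : Type*} [AddCommMonoid R] (F : List (Outcome J) → R) :
    ∑ l ∈ paths J 0, F l = F [] := by simp [paths]

lemma sum_paths_succ {J : ℕ} {R : Type*} [AddCommMonoid R] (k : ℕ) (F : List (Outcome J) → R) :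
    ∑ l ∈ paths J (k + 1), F l = ∑ a, ∑ l ∈ paths J k, F (a :: l) := by
  rw [paths, Finset.sum_image, Finset.sum_product]
  rintro ⟨a, l⟩ _ ⟨b, l'⟩ _ h
  simpa using h

lemma length_of_mem_paths {J k : ℕ} {l : List (Outcome J)} (h : l ∈ paths J k) :
    l.length = k := by
  induction k generalizing l with
  | zero => simp_all [paths]
  | succ k ih =>
    simp only [paths, Finset.mem_image, Finset.mem_product, Finset.mem_univ, true_and] at h
    obtain ⟨⟨a, l'⟩, hl', rfl⟩ := h
    simp [ih hl']

/-- The number of updates along an outcome sequence. -/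
def updateCount {J : ℕ} (l : List (Outcome J)) : ℕ := l.countP Option.isSome

/-- The answer to a query on which the current hypothesis takes the value `h`. -/
def answer {J : ℕ} (h : ℝ) : Outcome J → ℝ
  | none => h
  | some i => (i : ℝ) / J

/-- The mean of `g` under the hypothesis with log-weights `w`, i.e. the distribution on `X`
proportional to `exp w`. -/
def softMean {X : Type*} [Fintype X] (w g : X → ℝ) : ℝ :=
  (∑ x, Real.exp (w x) * g x) / ∑ x, Real.exp (w x)

/-- The multiplicative-weights update with rate `η`: upon a released value the hypothesis is
tilted along the query, towards that value. -/
def updateWeights {X : Type*} [Fintype X] {J : ℕ} (η : ℝ) (w g : X → ℝ) :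
    Outcome J → X → ℝ
  | none => w
  | some i => if softMean w g < (i : ℝ) / J then fun x => w x + η * g x
      else fun x => w x - η * g x

/-- A linear query as a real-valued function. -/
def queryFun {X : Type*} (f : LinearQuery X) : X → ℝ := fun x => (f x : ℝ)

/-- A deterministic adversary: the next query as a function of the outcomes so far, oldest
first. -/
abbrev QueryTree (X : Type u) (J : ℕ) : Type u := List (Outcome J) → LinearQuery X

/-- The rest of a query tree after the outcome `a` of its first query. -/
def QueryTree.tail {X : Type u} {J : ℕ} (q : QueryTree X J) (a : Outcome J) : QueryTree X J :=
  fun l => q (a :: l)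

/-- The likelihood of an outcome sequence on the sample `S`, when the outcome of a query has law
`K h y`, with `h` its value under the current hypothesis and `y` its empirical mean. -/
def pathProd {X : Type u} [Fintype X] {n J : ℕ} {R : Type*} [Mul R] [One R]
    (K : ℝ → ℝ → Outcome J → R) (η : ℝ) (S : Fin n → X) :
    QueryTree X J → (X → ℝ) → List (Outcome J) → R
  | _, _, [] => 1
  | q, w, a :: l => K (softMean w (queryFun (q []))) (sampleMean S (queryFun (q []))) a *
      pathProd K η S (q.tail a) (updateWeights η w (queryFun (q [])) a) l

lemma pathProd_pos {X : Type u} [Fintype X] {n J : ℕ} {P : ℝ → ℝ → Outcome J → ℝ}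
    (hP : ∀ h y a, 0 < P h y a) (η : ℝ) (S : Fin n → X) (q : QueryTree X J) (w : X → ℝ)
    (l : List (Outcome J)) : 0 < pathProd P η S q w l := by
  induction l generalizing q w with
  | nil => simp [pathProd]
  | cons a l ih => exact mul_pos (hP _ _ _) (ih _ _)

lemma sum_pathProd {X : Type u} [Fintype X] {n J : ℕ} {P : ℝ → ℝ → Outcome J → ℝ}
    (hP1 : ∀ h y, ∑ a, P h y a = 1) (η : ℝ) (S : Fin n → X) (k : ℕ) (q : QueryTree X J)
    (w : X → ℝ) : ∑ l ∈ paths J k, pathProd P η S q w l = 1 := by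
  induction k generalizing q w with
  | zero => simp [sum_paths_zero, pathProd]
  | succ k ih =>
    rw [sum_paths_succ]
    simp only [pathProd, ← Finset.mul_sum, ih, mul_one, hP1]

/-- The `p`-th moment of the likelihood ratio of two close laws on `Option ι`, when each outcome
other than `none` is discounted: the discount alone pays for the divergence, since that is at most
proportional to the probability of the discounted outcomes. -/
lemma sum_mul_ratio_pow_le_one {ι : Type*} [Fintype ι] {P P' : Option ι → ℝ}
    (hP : ∀ a, 0 < P a) (hP1 : ∑ a, P a = 1) (hP'1 : ∑ a, P' a = 1)
    {δ : ℝ} (hδ : 0 ≤ δ) (h : ∀ a, |P' a - P a| ≤ δ * P a) {p : ℕ} (hpδ : p * δ ≤ 1 / 4) :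
    ∑ a, P a * (P' a / P a) ^ p * (if a.isSome then 1 - 4 * (p * δ) ^ 2 else 1) ≤ 1 := by
  set ω := 1 - 4 * ((p : ℝ) * δ) ^ 2 with hω
  have hpδ0 : 0 ≤ p * δ := by positivity
  rcases Nat.eq_zero_or_pos p with rfl | hp
  · simp [hω, hP1]
  have hp1 : (1 : ℝ) ≤ p := by exact_mod_cast hp
  have hδ1 : δ ≤ 1 / 4 := by nlinarith
  have hup : ∀ a, P a * (P' a / P a) ^ p
      ≤ P a + p * (P' a - P a) + p ^ 2 * ((P' a - P a) ^ 2 / P a) := by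
    intro a
    have hPa := hP a
    set x := (P' a - P a) / P a with hx
    have hxδ : |x| ≤ δ := by rw [hx, abs_div, abs_of_pos hPa, div_le_iff₀ hPa]; exact h a
    have hρ : P' a / P a = 1 + x := by rw [hx]; field_simp; ring
    have hpx : |p * x| ≤ 1 := by
      rw [abs_mul, Nat.abs_cast]; nlinarith [abs_nonneg x]
    have h1 : (1 + x) ^ p ≤ Real.exp (p * x) := by
      rw [Real.exp_nat_mul]
      refine pow_le_pow_left₀ (by linarith [(abs_le.1 hxδ).1]) ?_ p
      linarith [Real.add_one_le_exp x]
    have h2 := (abs_le.1 (Real.abs_exp_sub_one_sub_id_le hpx)).2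
    have h3 : (1 + x) ^ p ≤ 1 + p * x + (p * x) ^ 2 := by linarith
    rw [hρ]
    calc P a * (1 + x) ^ p ≤ P a * (1 + p * x + (p * x) ^ 2) := by gcongr
      _ = _ := by rw [hx]; field_simp
  have hlow : ∀ a, 1 / 2 * P a ≤ P a * (P' a / P a) ^ p := by
    intro a
    have hPa := hP a
    have h1 : 1 - δ ≤ P' a / P a := by
      rw [le_div_iff₀ hPa]; linarith [(abs_le.1 (h a)).1]
    have h2 := one_add_mul_le_pow (a := -δ) (by linarith) p
    have h3 : (1 + -δ) ^ p ≤ (P' a / P a) ^ p := pow_le_pow_left₀ (by linarith) (by linarith) p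
    have : 1 / 2 ≤ (P' a / P a) ^ p := by linarith
    nlinarith
  rw [Fintype.sum_option] at hP1 hP'1 ⊢
  set t := ∑ i, P (some i) with ht
  set t' := ∑ i, P' (some i) with ht'
  have htt : |P' none - P none| ≤ δ * t := by
    have : P' none - P none = -∑ i, (P' (some i) - P (some i)) := by
      rw [Finset.sum_sub_distrib]; linarith
    rw [this, abs_neg, ht, Finset.mul_sum]
    exact (Finset.abs_sum_le_sum_abs _ _).trans (Finset.sum_le_sum fun i _ => h _)
  have hnone : (P' none - P none) ^ 2 / P none ≤ δ ^ 2 * t := by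
    rw [div_le_iff₀ (hP none), ← sq_abs]
    calc |P' none - P none| ^ 2 = |P' none - P none| * |P' none - P none| := by ring
      _ ≤ (δ * t) * (δ * P none) := by
          refine mul_le_mul htt (h none) (abs_nonneg _) ?_
          exact (abs_nonneg _).trans htt
      _ = _ := by ring
  have hsome : ∀ i : ι, P (some i) * (P' (some i) / P (some i)) ^ p * ω
      ≤ P (some i) + p * (P' (some i) - P (some i)) - (p * δ) ^ 2 * P (some i) := by
    intro i
    have hPi := hP (some i)
    have h1 := hup (some i)
    have h2 := hlow (some i)
    have h3 : (P' (some i) - P (some i)) ^ 2 / P (some i) ≤ δ ^ 2 * P (some i) := by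
      rw [div_le_iff₀ hPi, ← sq_abs]
      have := h (some i)
      have := pow_le_pow_left₀ (abs_nonneg _) this 2
      nlinarith
    have h4 : (p : ℝ) ^ 2 * ((P' (some i) - P (some i)) ^ 2 / P (some i))
        ≤ p ^ 2 * (δ ^ 2 * P (some i)) := by gcongr
    have h5 : 4 * (p * δ) ^ 2 * (1 / 2 * P (some i))
        ≤ 4 * (p * δ) ^ 2 * (P (some i) * (P' (some i) / P (some i)) ^ p) := by gcongr
    rw [hω]
    nlinarith
  have hn := hup none
  have hn2 : (p : ℝ) ^ 2 * ((P' none - P none) ^ 2 / P none) ≤ p ^ 2 * (δ ^ 2 * t) := by gcongr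
  have hs := Finset.sum_le_sum fun i (_ : i ∈ Finset.univ) => hsome i
  rw [Finset.sum_sub_distrib, Finset.sum_add_distrib, ← Finset.mul_sum, ← Finset.mul_sum,
    Finset.sum_sub_distrib, ← ht, ← ht'] at hs
  simp only [Option.isSome_none, Bool.false_eq_true, if_false, Option.isSome_some, if_true, mul_one]
  have : t' - t = P none - P' none := by linarith
  rw [this] at hs
  nlinarith

lemma queryFun_nonneg {X : Type*} (f : LinearQuery X) (x : X) : 0 ≤ queryFun f x := (f x).2.1

lemma queryFun_le_one {X : Type*} (f : LinearQuery X) (x : X) : queryFun f x ≤ 1 := (f x).2.2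

/-- Adaptive composition: along a query tree, the discounted moments of the likelihood ratio
multiply. -/
lemma sum_pathProd_ratio_discounted_le {X : Type u} [Fintype X] {n J : ℕ}
    {P : ℝ → ℝ → Outcome J → ℝ} (hP : ∀ h y a, 0 < P h y a) (hP1 : ∀ h y, ∑ a, P h y a = 1)
    {δ : ℝ} (hδ : 0 ≤ δ)
    (hPδ : ∀ (h y y' : ℝ) a, |y' - y| ≤ 1 / (n : ℝ) → |P h y' a - P h y a| ≤ δ * P h y a)
    {p : ℕ} (hpδ : p * δ ≤ 1 / 4) (η : ℝ) (S : Fin n → X) (j : Fin n) (z : X) (k : ℕ)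
    (q : QueryTree X J) (w : X → ℝ) :
    ∑ l ∈ paths J k, pathProd P η S q w l *
      (pathProd P η (Function.update S j z) q w l / pathProd P η S q w l) ^ p *
        (1 - 4 * (p * δ) ^ 2) ^ updateCount l ≤ 1 := by
  induction k generalizing q w with
  | zero => simp [sum_paths_zero, pathProd, updateCount]
  | succ k ih =>
    rw [sum_paths_succ]
    set h := softMean w (queryFun (q [])) with hh
    set y := sampleMean S (queryFun (q [])) with hy
    set y' := sampleMean (Function.update S j z) (queryFun (q [])) with hy'
    set ω := 1 - 4 * ((p : ℝ) * δ) ^ 2 with hω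
    have hpδ0 : 0 ≤ p * δ := by positivity
    have hω0 : 0 ≤ ω := by rw [hω]; nlinarith
    have hyy : |y' - y| ≤ 1 / n :=
      abs_sampleMean_update_sub_le S j z (queryFun_nonneg _) (queryFun_le_one _)
    refine le_trans ?_ (sum_mul_ratio_pow_le_one (P := P h y) (P' := P h y') (hP h y) (hP1 h y)
      (hP1 h y') hδ (fun a => hPδ h y y' a hyy) hpδ)
    refine Finset.sum_le_sum fun a _ => ?_
    have hstep : 0 ≤ P h y a * (P h y' a / P h y a) ^ p * (if a.isSome then ω else 1) := by
      have h1 := hP h y a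
      have h2 := hP h y' a
      have : 0 ≤ (if a.isSome then ω else 1) := by split_ifs <;> linarith
      positivity
    refine le_trans (le_of_eq ?_) (mul_le_of_le_one_right hstep
      (ih (q.tail a) (updateWeights η w (queryFun (q [])) a)))
    rw [Finset.mul_sum]
    refine Finset.sum_congr rfl fun l _ => ?_
    have hc : ω ^ updateCount (a :: l) = (if a.isSome then ω else 1) * ω ^ updateCount l := by
      unfold updateCount
      rw [List.countP_cons]
      split_ifs <;> simp [pow_succ, mul_comm]
    rw [hc]
    simp only [pathProd, ← hh, ← hy, ← hy']
    rw [mul_div_mul_comm, mul_pow]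
    ring

/-- The likelihood-ratio moment restricted to outcome sequences with at most `T` updates. -/
lemma sum_pathProd_ratio_le {X : Type u} [Fintype X] {n J : ℕ}
    {P : ℝ → ℝ → Outcome J → ℝ} (hP : ∀ h y a, 0 < P h y a) (hP1 : ∀ h y, ∑ a, P h y a = 1)
    {δ : ℝ} (hδ : 0 ≤ δ)
    (hPδ : ∀ (h y y' : ℝ) a, |y' - y| ≤ 1 / (n : ℝ) → |P h y' a - P h y a| ≤ δ * P h y a)
    {p : ℕ} (hpδ : p * δ ≤ 1 / 4) (η : ℝ) (S : Fin n → X) (j : Fin n) (z : X) (k : ℕ)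
    (q : QueryTree X J) (w : X → ℝ) (T : ℝ) :
    ∑ l ∈ paths J k with (updateCount l : ℝ) ≤ T, pathProd P η S q w l *
      (pathProd P η (Function.update S j z) q w l / pathProd P η S q w l) ^ p
        ≤ Real.exp (8 * (p * δ) ^ 2 * T) := by
  have hdisc := sum_pathProd_ratio_discounted_le hP hP1 hδ hPδ hpδ η S j z k q w
  set ω := 1 - 4 * ((p : ℝ) * δ) ^ 2 with hω
  have hpδ0 : 0 ≤ p * δ := by positivity
  have hω0 : 0 < ω := by rw [hω]; nlinarith
  have hexp : Real.exp (-(8 * (p * δ) ^ 2)) ≤ ω := by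
    set x := 8 * ((p : ℝ) * δ) ^ 2 with hx
    have hx0 : 0 ≤ x := by positivity
    have hx1 : x ≤ 1 / 2 := by rw [hx]; nlinarith
    have hωx : ω = 1 - x / 2 := by rw [hω, hx]; ring
    rw [hωx, Real.exp_neg, inv_le_comm₀ (Real.exp_pos _) (by linarith)]
    refine le_trans ?_ (Real.add_one_le_exp x)
    rw [inv_le_iff_one_le_mul₀ (by linarith)]
    nlinarith
  have hnn : ∀ l, 0 ≤ pathProd P η S q w l *
      (pathProd P η (Function.update S j z) q w l / pathProd P η S q w l) ^ p := by
    intro l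
    have h1 := pathProd_pos hP η S q w l
    have h2 := pathProd_pos hP η (Function.update S j z) q w l
    positivity
  have hterm : ∀ l ∈ (paths J k).filter (fun l => (updateCount l : ℝ) ≤ T),
      pathProd P η S q w l *
        (pathProd P η (Function.update S j z) q w l / pathProd P η S q w l) ^ p
      ≤ Real.exp (8 * (p * δ) ^ 2 * T) * (pathProd P η S q w l *
        (pathProd P η (Function.update S j z) q w l / pathProd P η S q w l) ^ p *
        ω ^ updateCount l) := by
    intro l hl
    have hlT : (updateCount l : ℝ) ≤ T := (Finset.mem_filter.1 hl).2
    have h1 : 1 ≤ Real.exp (8 * (p * δ) ^ 2 * T) * ω ^ updateCount l := by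
      have h2 : Real.exp (-(8 * (p * δ) ^ 2) * T) ≤ ω ^ updateCount l := by
        calc Real.exp (-(8 * (p * δ) ^ 2) * T)
            ≤ Real.exp (updateCount l * (-(8 * (p * δ) ^ 2))) := by
              rw [Real.exp_le_exp]; nlinarith [sq_nonneg ((p : ℝ) * δ)]
          _ = Real.exp (-(8 * (p * δ) ^ 2)) ^ updateCount l := Real.exp_nat_mul _ _
          _ ≤ _ := by gcongr
      calc (1 : ℝ) = Real.exp (8 * (p * δ) ^ 2 * T) * Real.exp (-(8 * (p * δ) ^ 2) * T) := by
            rw [← Real.exp_add]; simp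
        _ ≤ _ := by gcongr
    have := mul_le_mul_of_nonneg_left h1 (hnn l)
    linarith
  refine (Finset.sum_le_sum hterm).trans ?_
  rw [← Finset.mul_sum]
  refine mul_le_of_le_one_right (Real.exp_pos _).le (le_trans ?_ hdisc)
  refine Finset.sum_le_sum_of_subset_of_nonneg (Finset.filter_subset _ _) fun l _ _ => ?_
  have := hnn l
  positivity

/-! ### The potential of the hypothesis -/

lemma sum_exp_pos {X : Type*} [Fintype X] [Nonempty X] (w : X → ℝ) :
    0 < ∑ x, Real.exp (w x) :=
  Finset.sum_pos (fun _ _ => Real.exp_pos _) Finset.univ_nonempty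

lemma softMean_mem_Icc {X : Type*} [Fintype X] [Nonempty X] (w : X → ℝ) (f : LinearQuery X) :
    softMean w (queryFun f) ∈ Set.Icc (0 : ℝ) 1 := by
  have hW := sum_exp_pos w
  constructor
  · exact div_nonneg (Finset.sum_nonneg fun x _ =>
      mul_nonneg (Real.exp_pos _).le (queryFun_nonneg f x)) hW.le
  · rw [softMean, div_le_one hW]
    exact Finset.sum_le_sum fun x _ =>
      mul_le_of_le_one_right (Real.exp_pos _).le (queryFun_le_one f x)

lemma sampleMean_mem_Icc {X : Type*} {n : ℕ} (S : Fin n → X) (f : LinearQuery X) :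
    sampleMean S (queryFun f) ∈ Set.Icc (0 : ℝ) 1 := by
  constructor
  · exact div_nonneg (Finset.sum_nonneg fun i _ => queryFun_nonneg f _) (Nat.cast_nonneg n)
  · refine div_le_one_of_le₀ ?_ (Nat.cast_nonneg n)
    refine (Finset.sum_le_sum fun i _ => queryFun_le_one f _).trans ?_
    simp

/-- What the algorithm guarantees about the outcome of a query with empirical mean `y` on which the
hypothesis has value `h`: the answer is accurate on the sample, and an update only happens if the
hypothesis is off by a margin exceeding the error of the released value. -/
def IsGoodOutcome {J : ℕ} (α h y : ℝ) : Outcome J → Prop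
  | none => |y - h| ≤ α / 2
  | some i => |y - (i : ℝ) / J| ≤ α / 4 ∧ 5 * α / 16 ≤ |y - h|

lemma IsGoodOutcome.abs_answer_sub_le {J : ℕ} {α h y : ℝ} (hα : 0 ≤ α) {a : Outcome J}
    (ha : IsGoodOutcome α h y a) : |answer h a - y| ≤ α / 2 := by
  rw [abs_sub_comm]
  cases a with
  | none => exact ha
  | some i => exact ha.1.trans (by linarith)

/-- The potential of the multiplicative-weights argument: up to an additive constant, the divergence
of the hypothesis from the empirical distribution. -/
def potential {X : Type*} [Fintype X] {n : ℕ} (S : Fin n → X) (w : X → ℝ) : ℝ :=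
  Real.log (∑ x, Real.exp (w x)) - sampleMean S w

lemma potential_nonneg {X : Type*} [Fintype X] {n : ℕ} (hn : 0 < n) (S : Fin n → X)
    (w : X → ℝ) : 0 ≤ potential S w := by
  have hn' : (0 : ℝ) < n := by exact_mod_cast hn
  rw [potential, sub_nonneg, sampleMean, div_le_iff₀ hn']
  have h : ∀ i ∈ Finset.univ, w (S i) ≤ Real.log (∑ x, Real.exp (w x)) := by
    intro i _
    have h1 : Real.exp (w (S i)) ≤ ∑ x, Real.exp (w x) :=
      Finset.single_le_sum (f := fun x => Real.exp (w x)) (fun _ _ => (Real.exp_pos _).le)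
        (Finset.mem_univ _)
    rw [Real.le_log_iff_exp_le (lt_of_lt_of_le (Real.exp_pos _) h1)]
    exact h1
  refine (Finset.sum_le_sum h).trans (le_of_eq ?_)
  simp [mul_comm]

lemma potential_add_mul_le {X : Type*} [Fintype X] [Nonempty X] {n : ℕ} (S : Fin n → X)
    (w : X → ℝ) {g : X → ℝ} (hg0 : ∀ x, 0 ≤ g x) (hg1 : ∀ x, g x ≤ 1) {η : ℝ} (hη : |η| ≤ 1) :
    potential S (fun x => w x + η * g x)
      ≤ potential S w + η * (softMean w g - sampleMean S g) + η ^ 2 := by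
  have hW := sum_exp_pos w
  have h1 : ∑ x, Real.exp (w x + η * g x)
      ≤ (∑ x, Real.exp (w x)) * Real.exp (η * softMean w g + η ^ 2) := by
    have h2 : ∀ x ∈ Finset.univ, Real.exp (w x + η * g x)
        ≤ Real.exp (w x) + η * (Real.exp (w x) * g x) + η ^ 2 * Real.exp (w x) := by
      intro x _
      have hx : |η * g x| ≤ 1 := by
        rw [abs_mul, abs_of_nonneg (hg0 x)]
        nlinarith [abs_nonneg η, hg0 x, hg1 x]
      have h3 := (abs_le.1 (Real.abs_exp_sub_one_sub_id_le hx)).2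
      have h4 : (η * g x) ^ 2 ≤ η ^ 2 := by
        rw [mul_pow]
        exact mul_le_of_le_one_right (sq_nonneg _) (pow_le_one₀ (hg0 x) (hg1 x))
      rw [Real.exp_add]
      have := Real.exp_pos (w x)
      nlinarith
    refine (Finset.sum_le_sum h2).trans ?_
    rw [Finset.sum_add_distrib, Finset.sum_add_distrib, ← Finset.mul_sum, ← Finset.mul_sum]
    have h5 : ∑ x, Real.exp (w x) * g x = (∑ x, Real.exp (w x)) * softMean w g := by
      rw [softMean]; field_simp
    rw [h5]
    have := Real.add_one_le_exp (η * softMean w g + η ^ 2)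
    nlinarith
  have h6 : Real.log (∑ x, Real.exp (w x + η * g x))
      ≤ Real.log (∑ x, Real.exp (w x)) + (η * softMean w g + η ^ 2) := by
    refine (Real.log_le_log (sum_exp_pos _) h1).trans (le_of_eq ?_)
    rw [Real.log_mul hW.ne' (Real.exp_pos _).ne', Real.log_exp]
  have h7 : sampleMean S (fun x => w x + η * g x) = sampleMean S w + η * sampleMean S g := by
    simp only [sampleMean, Finset.sum_add_distrib, ← Finset.mul_sum]
    ring
  rw [potential, potential, h7]
  linarith

/-- A good update lowers the potential by a quarter of the squared margin. -/
lemma potential_updateWeights_le {X : Type*} [Fintype X] [Nonempty X] {n J : ℕ} (S : Fin n → X)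
    (w : X → ℝ) (f : LinearQuery X) {α : ℝ} (hα : 0 < α) (hα1 : α < 1) {a : Outcome J}
    (ha : IsGoodOutcome α (softMean w (queryFun f)) (sampleMean S (queryFun f)) a) :
    potential S (updateWeights (5 * α / 32) w (queryFun f) a)
      + (if a.isSome then 25 * α ^ 2 / 1024 else 0) ≤ potential S w := by
  cases a with
  | none => simp [updateWeights]
  | some i =>
    obtain ⟨h1, h2⟩ := ha
    set h := softMean w (queryFun f) with hh
    set y := sampleMean S (queryFun f) with hy
    have hη : |5 * α / 32| ≤ 1 := by rw [abs_of_pos (by positivity)]; linarith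
    have h1' := abs_le.1 h1
    simp only [updateWeights, ← hh, Option.isSome_some, if_true]
    split_ifs with hlt
    · have hs : 5 * α / 16 ≤ y - h := by
        rcases le_abs.1 h2 with h3 | h3 <;> linarith
      have := potential_add_mul_le S w (queryFun_nonneg f) (queryFun_le_one f) hη
      rw [← hh, ← hy] at this
      nlinarith
    · have hs : 5 * α / 16 ≤ h - y := by
        rcases le_abs.1 h2 with h3 | h3 <;> linarith
      have := potential_add_mul_le S w (queryFun_nonneg f) (queryFun_le_one f)
        (η := -(5 * α / 32)) (by rwa [abs_neg])
      rw [← hh, ← hy] at this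
      have e : (fun x => w x - 5 * α / 32 * queryFun f x)
          = fun x => w x + -(5 * α / 32) * queryFun f x := by
        funext x; ring
      rw [e]
      nlinarith

/-! ### Transcripts and violated queries -/

/-- The answered queries along an outcome sequence. -/
def pathTranscript {X : Type u} [Fintype X] {J : ℕ} (η : ℝ) :
    QueryTree X J → (X → ℝ) → List (Outcome J) → Transcript X
  | _, _, [] => []
  | q, w, a :: l => (q [], answer (softMean w (queryFun (q []))) a) ::
      pathTranscript η (q.tail a) (updateWeights η w (queryFun (q [])) a) l

/-- The first query whose answer is off by more than `α` from its mean, complemented if the answer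
is too small, so that in either case the mean is overestimated; zero if there is none. -/
def violatedQuery {X : Type u} [Fintype X] {J : ℕ} (d : X → ℝ) (α η : ℝ) :
    QueryTree X J → (X → ℝ) → List (Outcome J) → X → ℝ
  | _, _, [] => fun _ => 0
  | q, w, a :: l =>
      if α < answer (softMean w (queryFun (q []))) a - weightedMean d (queryFun (q [])) then
        queryFun (q [])
      else if α < weightedMean d (queryFun (q [])) - answer (softMean w (queryFun (q []))) a then
        fun x => 1 - queryFun (q []) x
      else violatedQuery d α η (q.tail a) (updateWeights η w (queryFun (q [])) a) l

lemma violatedQuery_mem_Icc {X : Type u} [Fintype X] {J : ℕ} (d : X → ℝ) (α η : ℝ)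
    (q : QueryTree X J) (w : X → ℝ) (l : List (Outcome J)) (x : X) :
    violatedQuery d α η q w l x ∈ Set.Icc (0 : ℝ) 1 := by
  induction l generalizing q w with
  | nil => simp [violatedQuery]
  | cons a l ih =>
    simp only [violatedQuery]
    have h0 := queryFun_nonneg (q []) x
    have h1 := queryFun_le_one (q []) x
    split_ifs
    · exact ⟨h0, h1⟩
    · exact ⟨by linarith, by linarith⟩
    · exact ih _ _

section goodKernel

variable {X : Type u} [Fintype X] {n J : ℕ} {α : ℝ} {κ : ℝ → ℝ → PMF (Outcome J)}

lemma updateCount_cons (a : Outcome J) (l : List (Outcome J)) :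
    updateCount (a :: l) = updateCount l + if a.isSome then 1 else 0 := by
  unfold updateCount
  rw [List.countP_cons]

/-- Since the potential is nonnegative, the updates are few. -/
lemma updateCount_mul_le_potential [Nonempty X] (hα : 0 < α) (hα1 : α < 1) (hn : 0 < n)
    (hκ : ∀ h ∈ Set.Icc (0 : ℝ) 1, ∀ y ∈ Set.Icc (0 : ℝ) 1, ∀ a, κ h y a ≠ 0 →
      IsGoodOutcome α h y a)
    (S : Fin n → X) (q : QueryTree X J) (w : X → ℝ) (l : List (Outcome J))
    (hl : pathProd (fun h y a => κ h y a) (5 * α / 32) S q w l ≠ 0) :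
    updateCount l * (25 * α ^ 2 / 1024) ≤ potential S w := by
  induction l generalizing q w with
  | nil => simpa [updateCount] using potential_nonneg hn S w
  | cons a l ih =>
    obtain ⟨h1, h2⟩ := mul_ne_zero_iff.1 hl
    have hg := hκ _ (softMean_mem_Icc w (q [])) _ (sampleMean_mem_Icc S (q [])) a h1
    have h3 := ih _ _ h2
    have h4 := potential_updateWeights_le S w (q []) hα hα1 hg
    rw [updateCount_cons]
    push_cast
    split_ifs at h4 ⊢ <;> simp <;> linarith

/-- A violated answer is accurate on the sample, so the sample misrepresents its query. -/
lemma le_sampleMean_violatedQuery_sub [Nonempty X] (hα : 0 < α) (hn : 0 < n)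
    (hκ : ∀ h ∈ Set.Icc (0 : ℝ) 1, ∀ y ∈ Set.Icc (0 : ℝ) 1, ∀ a, κ h y a ≠ 0 →
      IsGoodOutcome α h y a)
    {D : PMF X} {d : X → ℝ} (hd : d = fun x => (D x).toReal) (hd1 : ∑ x, d x = 1) {η : ℝ}
    (S : Fin n → X) (q : QueryTree X J) (w : X → ℝ) (l : List (Outcome J))
    (hl : pathProd (fun h y a => κ h y a) η S q w l ≠ 0)
    (hbad : pathTranscript η q w l ∉ accurateTranscripts D α) :
    α / 2 ≤ sampleMean S (violatedQuery d α η q w l)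
      - weightedMean d (violatedQuery d α η q w l) := by
  have hn' : (n : ℝ) ≠ 0 := by exact_mod_cast hn.ne'
  induction l generalizing q w with
  | nil => simp [pathTranscript, accurateTranscripts] at hbad
  | cons a l ih =>
    obtain ⟨h1, h2⟩ := mul_ne_zero_iff.1 hl
    have hg := (hκ _ (softMean_mem_Icc w (q [])) _ (sampleMean_mem_Icc S (q []))
      a h1).abs_answer_sub_le hα.le
    have hg' := abs_le.1 hg
    simp only [violatedQuery]
    split_ifs with h3 h4
    · linarith
    · have e1 : sampleMean S (fun x => 1 - queryFun (q []) x)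
          = 1 - sampleMean S (queryFun (q [])) := by
        simp [sampleMean, Finset.sum_sub_distrib]; field_simp
      have e2 : weightedMean d (fun x => 1 - queryFun (q []) x)
          = 1 - weightedMean d (queryFun (q [])) := by
        simp [weightedMean, mul_sub, Finset.sum_sub_distrib, hd1]
      rw [e1, e2]; linarith
    · refine ih _ _ h2 fun hacc => hbad ?_
      intro z hz
      rcases List.mem_cons.1 hz with rfl | hz
      · have e : populationValue D (q []) = weightedMean d (queryFun (q [])) := by rw [hd]; rfl
        rw [e, abs_le]
        constructor <;> linarith
      · exact hacc z hz

lemma pathProd_le_ofReal [Nonempty X] {P : ℝ → ℝ → Outcome J → ℝ} (hP : ∀ h y a, 0 < P h y a)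
    {r c : ℝ} (hr : 0 ≤ r) (hc : 0 ≤ c)
    (hdom : ∀ h ∈ Set.Icc (0 : ℝ) 1, ∀ y ∈ Set.Icc (0 : ℝ) 1, ∀ a,
      κ h y a ≤ ENNReal.ofReal (r * (if a.isSome then c else 1) * P h y a))
    {η : ℝ} (S : Fin n → X) (q : QueryTree X J) (w : X → ℝ) (l : List (Outcome J)) :
    pathProd (fun h y a => κ h y a) η S q w l
      ≤ ENNReal.ofReal (r ^ l.length * c ^ updateCount l * pathProd P η S q w l) := by
  induction l generalizing q w with
  | nil => simp [pathProd, updateCount]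
  | cons a l ih =>
    refine (mul_le_mul' (hdom _ (softMean_mem_Icc w (q [])) _ (sampleMean_mem_Icc S (q [])) a)
      (ih _ _)).trans (le_of_eq ?_)
    have hc' : 0 ≤ (if a.isSome then c else 1) := by split_ifs <;> simp [hc]
    rw [← ENNReal.ofReal_mul (mul_nonneg (mul_nonneg hr hc') (hP _ _ _).le)]
    congr 1
    rw [updateCount_cons, List.length_cons, pathProd]
    split_ifs <;> simp only [pow_succ, add_zero] <;> ring

end goodKernel

/-! ### Accuracy of private multiplicative weights -/

/-- Private multiplicative weights: the state holds the sample and the log-weights of a hypothesis;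
the reaction to a query is drawn from a kernel `κ` which depends only on the value of the query
under the hypothesis and on its empirical mean. -/
def mwAlgorithm (X : Type u) [Fintype X] (n : ℕ) {J : ℕ} (κ : ℝ → ℝ → PMF (Outcome J)) (η : ℝ) :
    Algorithm X n where
  State := (Fin n → X) × (X → ℝ)
  init S := PMF.pure (S, 0)
  step σ f := (κ (softMean σ.2 (queryFun f)) (sampleMean σ.1 (queryFun f))).map fun a =>
    ((σ.1, updateWeights η σ.2 (queryFun f) a), answer (softMean σ.2 (queryFun f)) a)

lemma PMF_exists_tsum_mul_le {ι : Type*} (p : PMF ι) {g : ι → ENNReal} {K : ENNReal}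
    (hK : K ≠ ⊤) (hg : ∀ i, g i ≤ K) : ∃ i, ∑' j, p j * g j ≤ g i := by
  by_contra! h
  set A := ∑' j, p j * g j with hA
  have hAK : A ≤ K := by
    calc A ≤ ∑' j, p j * K := ENNReal.tsum_le_tsum fun j => by gcongr; exact hg j
      _ = K := by rw [ENNReal.tsum_mul_right, p.tsum_coe, one_mul]
  obtain ⟨i, hi⟩ := p.support_nonempty
  have : A < ∑' j, p j * A := by
    rw [hA]
    refine ENNReal.tsum_lt_tsum (i := i) (ne_top_of_le_ne_top hK hAK) (fun j => ?_) ?_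
    · exact mul_le_mul_right (h j).le _
    · exact (ENNReal.mul_lt_mul_iff_right ((p.mem_support_iff i).1 hi) (p.apply_ne_top i)).2 (h i)
  rw [ENNReal.tsum_mul_right, p.tsum_coe, one_mul] at this
  exact lt_irrefl _ this

/-- Derandomization of the adversary: some query tree does at least as well as a given randomized
adversary at driving the transcript into `E`. -/
lemma exists_queryTree_le {X : Type u} [Fintype X] {n J : ℕ} (κ : ℝ → ℝ → PMF (Outcome J))
    (η : ℝ) (B : Adversary X) (E : Set (Transcript X)) [DecidablePred (· ∈ E)] (k : ℕ)
    (c : (Fin n → X) → ENNReal) (hc : ∑ S, c S ≠ ⊤) (w : X → ℝ) (h : Transcript X) :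
    ∃ q : QueryTree X J,
      ∑ S, c S * (interact (mwAlgorithm X n κ η) B k (S, w) h).toOuterMeasure E
        ≤ ∑ S, c S * ∑ l ∈ paths J k, pathProd (fun h y a => κ h y a) η S q w l *
            (if h ++ pathTranscript η q w l ∈ E then 1 else 0) := by
  induction k generalizing c w h with
  | zero =>
    refine ⟨fun _ _ => ⟨0, by simp⟩, le_of_eq ?_⟩
    refine Finset.sum_congr rfl fun S _ => ?_
    rw [sum_paths_zero]
    simp only [interact, pathProd, pathTranscript, List.append_nil, one_mul,
      PMF.toOuterMeasure_pure_apply]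
    by_cases hE : h ∈ E <;> simp [hE]
  | succ k ih =>
    -- the value of asking `f` and continuing with `B`
    let G : LinearQuery X → Outcome J → (Fin n → X) → ENNReal := fun f a S =>
      κ (softMean w (queryFun f)) (sampleMean S (queryFun f)) a *
        (interact (mwAlgorithm X n κ η) B k (S, updateWeights η w (queryFun f) a)
          (h ++ [(f, answer (softMean w (queryFun f)) a)])).toOuterMeasure E
    have hstep : ∀ S : Fin n → X,
        (interact (mwAlgorithm X n κ η) B (k + 1) (S, w) h).toOuterMeasure E
          = ∑' f, B h f * ∑ a, G f a S := by
      intro S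
      change ((B h).bind fun f => ((mwAlgorithm X n κ η).step (S, w) f).bind fun r =>
        interact (mwAlgorithm X n κ η) B k r.1 (h ++ [(f, r.2)])).toOuterMeasure E = _
      rw [PMF.toOuterMeasure_bind_apply]
      refine tsum_congr fun f => ?_
      congr 1
      rw [← tsum_fintype (L := SummationFilter.unconditional (Outcome J))]
      simp only [mwAlgorithm, PMF.bind_map, PMF.toOuterMeasure_bind_apply, Function.comp_apply, G]
    have hle1 : ∀ (μ : PMF (Transcript X)), μ.toOuterMeasure E ≤ 1 := fun μ => by
      rw [PMF.toOuterMeasure_apply, ← μ.tsum_coe]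
      exact ENNReal.tsum_le_tsum fun t => Set.indicator_le_self _ _ _
    have hG1 : ∀ f S, ∑ a, G f a S ≤ 1 := by
      intro f S
      calc ∑ a, G f a S ≤ ∑ a, κ (softMean w (queryFun f)) (sampleMean S (queryFun f)) a :=
            Finset.sum_le_sum fun a _ => mul_le_of_le_one_right' (hle1 _)
        _ = 1 := by
            rw [← tsum_fintype (L := SummationFilter.unconditional (Outcome J))]
            exact PMF.tsum_coe _
    obtain ⟨f, hf⟩ := PMF_exists_tsum_mul_le (B h) (g := fun f => ∑ S, c S * ∑ a, G f a S)
      hc (fun f => Finset.sum_le_sum fun S _ => mul_le_of_le_one_right' (hG1 f S))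
    have hIH : ∀ a : Outcome J, ∃ q : QueryTree X J, _ := fun a =>
      ih (fun S => c S * κ (softMean w (queryFun f)) (sampleMean S (queryFun f)) a)
        (ne_top_of_le_ne_top hc (Finset.sum_le_sum fun S _ =>
          mul_le_of_le_one_right' (PMF.coe_le_one _ _)))
        (updateWeights η w (queryFun f) a) (h ++ [(f, answer (softMean w (queryFun f)) a)])
    choose qa hqa using hIH
    refine ⟨fun l => match l with | [] => f | a :: l => qa a l, ?_⟩
    calc ∑ S, c S * (interact (mwAlgorithm X n κ η) B (k + 1) (S, w) h).toOuterMeasure E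
        = ∑' f, B h f * ∑ S, c S * ∑ a, G f a S := by
          simp only [hstep, ← ENNReal.tsum_mul_left, Finset.mul_sum]
          rw [← Summable.tsum_finsetSum fun _ _ => ENNReal.summable]
          refine tsum_congr fun f => Finset.sum_congr rfl fun S _ =>
            Finset.sum_congr rfl fun a _ => by ring
      _ ≤ ∑ S, c S * ∑ a, G f a S := hf
      _ = ∑ a, ∑ S, c S * κ (softMean w (queryFun f)) (sampleMean S (queryFun f)) a *
            (interact (mwAlgorithm X n κ η) B k (S, updateWeights η w (queryFun f) a)
              (h ++ [(f, answer (softMean w (queryFun f)) a)])).toOuterMeasure E := by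
          rw [Finset.sum_comm]
          refine Finset.sum_congr rfl fun S _ => ?_
          rw [Finset.mul_sum]
          exact Finset.sum_congr rfl fun a _ => by simp only [G]; ring
      _ ≤ _ := Finset.sum_le_sum fun a _ => hqa a
      _ = _ := by
          rw [Finset.sum_comm]
          refine Finset.sum_congr rfl fun S _ => ?_
          rw [sum_paths_succ, Finset.mul_sum]
          refine Finset.sum_congr rfl fun a _ => ?_
          rw [mul_assoc]
          congr 1
          rw [Finset.mul_sum]
          refine Finset.sum_congr rfl fun l _ => ?_
          simp only [pathProd, pathTranscript, mul_assoc, List.append_assoc, List.cons_append,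
            List.nil_append]
          rfl

lemma PMF_sum_toReal {X : Type*} [Fintype X] (D : PMF X) : ∑ x, (D x).toReal = 1 := by
  rw [← ENNReal.toReal_sum fun x _ => D.apply_ne_top x,
    ← tsum_fintype (L := SummationFilter.unconditional X), D.tsum_coe, ENNReal.toReal_one]

lemma iidSample_apply {X : Type u} [Fintype X] (n : ℕ) (D : PMF X) (S : Fin n → X) :
    iidSample n D S = ENNReal.ofReal (sampleWeight (fun x => (D x).toReal) S) := by
  rw [sampleWeight, ENNReal.ofReal_prod_of_nonneg fun _ _ => ENNReal.toReal_nonneg]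
  simp only [ENNReal.ofReal_toReal (D.apply_ne_top _)]
  rfl

lemma le_toReal_toOuterMeasure_of_compl {ι : Type*} (μ : PMF ι) (E : Set ι) {β : ℝ} (hβ : 0 ≤ β)
    (h : μ.toOuterMeasure Eᶜ ≤ ENNReal.ofReal β) : 1 - β ≤ (μ.toOuterMeasure E).toReal := by
  have h1 : μ.toOuterMeasure E + μ.toOuterMeasure Eᶜ = 1 := by
    rw [PMF.toOuterMeasure_apply, PMF.toOuterMeasure_apply, ← ENNReal.tsum_add, ← μ.tsum_coe]
    exact tsum_congr fun i => congrFun (Set.indicator_self_add_compl E μ) i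
  have hE : μ.toOuterMeasure E ≠ ⊤ := fun h' => by simp [h'] at h1
  have hE' : μ.toOuterMeasure Eᶜ ≠ ⊤ := fun h' => by simp [h'] at h1
  have h2 := congrArg ENNReal.toReal h1
  rw [ENNReal.toReal_add hE hE', ENNReal.toReal_one] at h2
  have h3 := ENNReal.toReal_le_of_le_ofReal hβ h
  linarith

/-- Accuracy of private multiplicative weights: the kernel `κ` only yields good outcomes and is
dominated by a positive kernel `P`, up to a factor `1 + 1 / m` per query and an additional factor
`c` per update; and `P` is stable, with relative change at most `δ` if one sample is exchanged. -/
theorem mwAlgorithm_isAccurate {X : Type u} [Fintype X] {n J m : ℕ} {α β : ℝ}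
    (hα : 0 < α) (hα1 : α < 1) (hβ : 0 ≤ β) (hm : 1 ≤ m)
    {κ : ℝ → ℝ → PMF (Outcome J)}
    (hκ : ∀ h ∈ Set.Icc (0 : ℝ) 1, ∀ y ∈ Set.Icc (0 : ℝ) 1, ∀ a, κ h y a ≠ 0 →
      IsGoodOutcome α h y a)
    {P : ℝ → ℝ → Outcome J → ℝ} (hP : ∀ h y a, 0 < P h y a) (hP1 : ∀ h y, ∑ a, P h y a = 1)
    {c : ℝ} (hc : 1 ≤ c)
    (hdom : ∀ h ∈ Set.Icc (0 : ℝ) 1, ∀ y ∈ Set.Icc (0 : ℝ) 1, ∀ a,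
      κ h y a ≤ ENNReal.ofReal ((1 + 1 / (m : ℝ)) * (if a.isSome then c else 1) * P h y a))
    {δ : ℝ} (hδ : 0 ≤ δ)
    (hPδ : ∀ (h y y' : ℝ) a, |y' - y| ≤ 1 / (n : ℝ) → |P h y' a - P h y a| ≤ δ * P h y a)
    {B T : ℝ} (hB : 1 ≤ B) (hT : 1024 / (25 * α ^ 2) * Real.log (Fintype.card X) ≤ T)
    (hδB : 66 * B / α * δ ≤ 1 / 4) (hδT : 8 * (66 * B / α * δ) ^ 2 * T ≤ B)
    (hn : 528 * B / α ^ 2 ≤ n)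
    (hβB : Real.exp 1 * Real.exp (T * Real.log c) * (2 * Real.exp (-(2 * B))) ≤ β) :
    IsAccurate (mwAlgorithm X n κ (5 * α / 32)) α β m := by
  classical
  intro D Adv
  refine le_toReal_toOuterMeasure_of_compl _ _ hβ ?_
  obtain ⟨x0, -⟩ := D.support_nonempty
  have : Nonempty X := ⟨x0⟩
  set d : X → ℝ := fun x => (D x).toReal with hd
  have hd0 : ∀ x, 0 ≤ d x := fun x => ENNReal.toReal_nonneg
  have hd1 : ∑ x, d x = 1 := PMF_sum_toReal D
  have hn' : (0 : ℝ) < n := lt_of_lt_of_le (by positivity) hn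
  have hn0 : 0 < n := by exact_mod_cast hn'
  have hm' : (0 : ℝ) < m := by exact_mod_cast hm
  set η := 5 * α / 32 with hη
  have hT0 : 0 ≤ T := le_trans (mul_nonneg (by positivity) (Real.log_natCast_nonneg _)) hT
  have hsum : ∑ S, iidSample n D S ≠ ⊤ := by
    rw [← tsum_fintype (L := SummationFilter.unconditional (Fin n → X)), PMF.tsum_coe]
    exact ENNReal.one_ne_top
  obtain ⟨q, hq⟩ := exists_queryTree_le κ η Adv (accurateTranscripts D α)ᶜ m
    (fun S => iidSample n D S) hsum 0 []
  have hexp : (experiment (mwAlgorithm X n κ η) Adv D m).toOuterMeasure (accurateTranscripts D α)ᶜ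
      = ∑ S, iidSample n D S * (interact (mwAlgorithm X n κ η) Adv m (S, 0) []).toOuterMeasure
          (accurateTranscripts D α)ᶜ := by
    rw [experiment, PMF.toOuterMeasure_bind_apply, tsum_fintype]
    refine Finset.sum_congr rfl fun S _ => ?_
    congr 1
    exact congrArg (fun μ : PMF (Transcript X) => μ.toOuterMeasure _) (PMF.pure_bind _ _)
  rw [hexp]
  refine hq.trans ?_
  set φ := violatedQuery d α η q 0 with hφ
  set Q : ℝ := Real.exp 1 * Real.exp (T * Real.log c) with hQ
  set s := (paths J m).filter (fun l => (updateCount l : ℝ) ≤ T) with hs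
  set p := ⌈32 * B / (α / 2)⌉₊ with hp
  have hp1 : 32 * B / (α / 2) ≤ p := Nat.le_ceil _
  have hp2 : (p : ℝ) ≤ 33 * B / (α / 2) := by
    have h1 := (Nat.ceil_lt_add_one (a := 32 * B / (α / 2)) (by positivity)).le
    have h2 : 1 ≤ B / (α / 2) := by rw [one_le_div (by positivity)]; linarith
    have h3 : 33 * B / (α / 2) = 32 * B / (α / 2) + B / (α / 2) := by ring
    rw [h3]; exact h1.trans (by linarith)
  have hpδ : p * δ ≤ 66 * B / α * δ := by
    refine mul_le_mul_of_nonneg_right (hp2.trans (le_of_eq ?_)) hδ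
    field_simp; ring
  have hpath : ∀ S : Fin n → X, ∑ l ∈ paths J m, pathProd (fun h y a => κ h y a) η S q 0 l *
        (if [] ++ pathTranscript η q 0 l ∈ (accurateTranscripts D α)ᶜ then 1 else 0)
      ≤ ENNReal.ofReal (Q * ∑ l ∈ s, if α / 2 ≤ sampleMean S (φ l) - weightedMean d (φ l) then
          pathProd P η S q 0 l else 0) := by
    intro S
    have hnn : ∀ l, 0 ≤ (if α / 2 ≤ sampleMean S (φ l) - weightedMean d (φ l) then
        pathProd P η S q 0 l else 0) := by
      intro l
      split_ifs
      · exact (pathProd_pos hP η S q 0 l).le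
      · exact le_rfl
    rw [Finset.mul_sum, ENNReal.ofReal_sum_of_nonneg fun l _ => mul_nonneg (by positivity) (hnn l),
      hs, Finset.sum_filter]
    refine Finset.sum_le_sum fun l hl => ?_
    by_cases h0 : pathProd (fun h y a => (κ h y a : ENNReal)) η S q 0 l = 0
    · rw [h0, zero_mul]; exact zero_le
    by_cases hbad : pathTranscript η q 0 l ∈ accurateTranscripts D α
    · simp [hbad]
    have hcount : (updateCount l : ℝ) ≤ T := by
      have h1 := updateCount_mul_le_potential hα hα1 hn0 hκ S q 0 l h0
      have h2 : potential S (0 : X → ℝ) = Real.log (Fintype.card X) := by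
        simp [potential, sampleMean]
      rw [h2] at h1
      refine le_trans ?_ hT
      rw [div_mul_eq_mul_div, le_div_iff₀ (by positivity)]
      linarith
    have hviol := le_sampleMean_violatedQuery_sub hα hn0 hκ hd hd1 S q 0 l h0 hbad
    rw [if_pos hcount, ← hφ] at *
    rw [if_pos hviol]
    refine (mul_le_of_le_one_right' (by split_ifs <;> simp)).trans
      ((pathProd_le_ofReal hP (by positivity) (by linarith) hdom S q 0 l).trans ?_)
    refine ENNReal.ofReal_le_ofReal (mul_le_mul_of_nonneg_right ?_ (pathProd_pos hP η S q 0 l).le)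
    rw [hQ]
    refine mul_le_mul ?_ ?_ (by positivity) (Real.exp_pos _).le
    · rw [length_of_mem_paths hl]
      calc (1 + 1 / (m : ℝ)) ^ m ≤ Real.exp (1 / m) ^ m := by
            gcongr
            linarith [Real.add_one_le_exp (1 / (m : ℝ))]
        _ = Real.exp 1 := by
            rw [← Real.exp_nat_mul]; congr 1; field_simp
    · calc c ^ updateCount l = Real.exp (updateCount l * Real.log c) := by
            rw [Real.exp_nat_mul, Real.exp_log (by linarith)]
        _ ≤ _ := by
            rw [Real.exp_le_exp]
            exact mul_le_mul_of_nonneg_right hcount (Real.log_nonneg hc)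
  have htail := tail_le_two_mul_exp hd0 hd1 s (fun S l => pathProd P η S q 0 l)
    (fun S l => pathProd_pos hP η S q 0 l)
    (fun S => by
      rw [← sum_pathProd hP1 η S m q 0]
      exact Finset.sum_le_sum_of_subset_of_nonneg (Finset.filter_subset _ _)
        fun l _ _ => (pathProd_pos hP η S q 0 l).le)
    φ (fun l x => (violatedQuery_mem_Icc d α η q 0 l x).1)
    (fun l x => (violatedQuery_mem_Icc d α η q 0 l x).2) (p := p) (B := B) (τ := α / 2) hB
    (by positivity) (by linarith) hp1 hp2
    (by refine le_trans (le_of_eq ?_) hn; field_simp; ring)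
    (fun S j y => by
      refine (sum_pathProd_ratio_le hP hP1 hδ hPδ (hpδ.trans hδB) η S j y m q 0 T).trans ?_
      rw [Real.exp_le_exp]
      refine le_trans ?_ hδT
      have : 0 ≤ p * δ := by positivity
      gcongr)
  calc _ ≤ ∑ S, ENNReal.ofReal (sampleWeight d S) * ENNReal.ofReal (Q * ∑ l ∈ s,
          if α / 2 ≤ sampleMean S (φ l) - weightedMean d (φ l) then
          pathProd P η S q 0 l else 0) := by
        refine Finset.sum_le_sum fun S _ => ?_
        rw [iidSample_apply]
        exact mul_le_mul_right (hpath S) _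
    _ = ENNReal.ofReal (Q * ∑ S, sampleWeight d S * ∑ l ∈ s,
          if α / 2 ≤ sampleMean S (φ l) - weightedMean d (φ l) then
          pathProd P η S q 0 l else 0) := by
        have hnn : ∀ S : Fin n → X, 0 ≤ ∑ l ∈ s,
            if α / 2 ≤ sampleMean S (φ l) - weightedMean d (φ l) then
              pathProd P η S q 0 l else 0 := by
          intro S
          refine Finset.sum_nonneg fun l _ => ?_
          split_ifs
          · exact (pathProd_pos hP η S q 0 l).le
          · exact le_rfl
        have hw := sampleWeight_nonneg hd0 (n := n)
        have hQ0 : 0 ≤ Q := by positivity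
        rw [Finset.mul_sum, ENNReal.ofReal_sum_of_nonneg fun S _ =>
          mul_nonneg hQ0 (mul_nonneg (hw S) (hnn S))]
        refine Finset.sum_congr rfl fun S _ => ?_
        rw [← ENNReal.ofReal_mul (hw S)]
        congr 1
        ring
    _ ≤ ENNReal.ofReal β := by
        refine ENNReal.ofReal_le_ofReal (le_trans ?_ hβB)
        exact mul_le_mul_of_nonneg_left htail (by positivity)

/-! ### Kernels for the two regimes -/

lemma sum_exp_neg_abs_sub_le {J : ℕ} (hJ : 1 ≤ J) {v y : ℝ} (hv : (J : ℝ) ≤ v) (hy : 0 ≤ y) :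
    ∑ i : Fin (J + 1), Real.exp (-(v * |y - (i : ℝ) / J|)) ≤ 4 := by
  have hJ' : (0 : ℝ) < J := by exact_mod_cast hJ
  set k := ⌊y * J⌋₊ with hk
  have hk1 : (k : ℝ) ≤ y * J := Nat.floor_le (by positivity)
  have hk2 : y * J < k + 1 := Nat.lt_floor_add_one _
  have hexp : ∀ a : ℕ, Real.exp (-(a : ℝ)) ≤ (1 / 2) ^ a := by
    intro a
    have h1 : Real.exp (-1) ≤ 1 / 2 := by
      rw [Real.exp_neg, inv_le_comm₀ (Real.exp_pos _) (by norm_num)]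
      have := Real.add_one_le_exp (1 : ℝ)
      norm_num at this ⊢
      linarith
    calc Real.exp (-(a : ℝ)) = Real.exp (-1) ^ a := by rw [← Real.exp_nat_mul]; ring_nf
      _ ≤ _ := by gcongr
  set F : ℕ → ℝ := fun i => Real.exp (-(v * |y - (i : ℝ) / J|)) with hF
  have hFle : ∀ (i a : ℕ), (a : ℝ) ≤ |y * J - i| → F i ≤ (1 / 2) ^ a := by
    intro i a ha
    refine le_trans ?_ (hexp a)
    rw [hF, Real.exp_le_exp, neg_le_neg_iff]
    have h1 : |y * J - i| = J * |y - i / J| := by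
      rw [← abs_of_pos hJ', ← abs_mul, abs_of_pos hJ']; congr 1; field_simp
    rw [h1] at ha
    exact ha.trans (mul_le_mul_of_nonneg_right hv (abs_nonneg _))
  calc ∑ i : Fin (J + 1), Real.exp (-(v * |y - (i : ℝ) / J|))
      = ∑ i ∈ Finset.range (J + 1), F i := (Finset.sum_range F).symm
    _ ≤ ∑ i ∈ Finset.range (k + 1 + (J + 1)), F i := by
        refine Finset.sum_le_sum_of_subset_of_nonneg ?_ fun i _ _ => (Real.exp_pos _).le
        exact Finset.range_subset_range.2 (by omega)
    _ = ∑ i ∈ Finset.range (k + 1), F i + ∑ i ∈ Finset.range (J + 1), F (k + 1 + i) :=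
        Finset.sum_range_add _ _ _
    _ ≤ ∑ i ∈ Finset.range (k + 1), (1 / 2 : ℝ) ^ (k + 1 - 1 - i)
          + ∑ i ∈ Finset.range (J + 1), (1 / 2 : ℝ) ^ i := by
        refine add_le_add (Finset.sum_le_sum fun i hi => hFle _ _ ?_)
          (Finset.sum_le_sum fun i _ => hFle _ _ ?_)
        · have : i ≤ k := by rw [Finset.mem_range] at hi; omega
          rw [Nat.add_sub_cancel, Nat.cast_sub this]
          exact le_trans (by linarith) (le_abs_self _)
        · push_cast
          exact le_trans (by linarith) (neg_le_abs _)
    _ ≤ 2 + 2 := by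
        rw [Finset.sum_range_reflect (fun i => (1 / 2 : ℝ) ^ i)]
        exact add_le_add (sum_geometric_two_le _) (sum_geometric_two_le _)
    _ = 4 := by norm_num

lemma exists_abs_sub_div_le {J : ℕ} (hJ : 1 ≤ J) {y : ℝ} (hy : y ∈ Set.Icc (0 : ℝ) 1) :
    ∃ i : Fin (J + 1), |y - (i : ℝ) / J| ≤ 1 / J := by
  have hJ' : (0 : ℝ) < J := by exact_mod_cast hJ
  have hk1 : (⌊y * J⌋₊ : ℝ) ≤ y * J := Nat.floor_le (mul_nonneg hy.1 hJ'.le)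
  have hk2 : y * J < ⌊y * J⌋₊ + 1 := Nat.lt_floor_add_one _
  have hkJ : ⌊y * J⌋₊ ≤ J := by
    have : (⌊y * J⌋₊ : ℝ) ≤ J := by nlinarith [hy.2]
    exact_mod_cast this
  refine ⟨⟨⌊y * J⌋₊, by omega⟩, ?_⟩
  have h1 : y - (⌊y * J⌋₊ : ℝ) / J = (y * J - ⌊y * J⌋₊) / J := by field_simp
  simp only [h1]
  rw [abs_div, abs_of_pos hJ', abs_of_nonneg (by linarith)]
  gcongr
  linarith

/-- The scores of the exponential mechanism: keeping the hypothesis is favoured by `6 * ℓ`, and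
errors are penalized at rate `u`. -/
def score {J : ℕ} (u ℓ h y : ℝ) : Outcome J → ℝ
  | none => 6 * ℓ - u * |y - h|
  | some i => -(u * |y - (i : ℝ) / J|)

/-- The exponential mechanism with the scores `score`. -/
def expKernel {J : ℕ} (u ℓ h y : ℝ) (a : Outcome J) : ℝ :=
  Real.exp (score u ℓ h y a) / ∑ b : Outcome J, Real.exp (score u ℓ h y b)

lemma expKernel_pos {J : ℕ} (u ℓ h y : ℝ) (a : Outcome J) : 0 < expKernel u ℓ h y a :=
  div_pos (Real.exp_pos _) (sum_exp_pos _)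

lemma sum_expKernel {J : ℕ} (u ℓ h y : ℝ) : ∑ a : Outcome J, expKernel u ℓ h y a = 1 := by
  simp only [expKernel]
  rw [← Finset.sum_div, div_self (sum_exp_pos _).ne']

lemma abs_score_sub_le {J : ℕ} {u : ℝ} (hu : 0 ≤ u) (ℓ h y y' : ℝ) (a : Outcome J) :
    |score u ℓ h y' a - score u ℓ h y a| ≤ u * |y' - y| := by
  have key : ∀ z : ℝ, abs (u * |y - z| - u * |y' - z|) ≤ u * |y' - y| := by
    intro z
    rw [← mul_sub, abs_mul, abs_of_nonneg hu]
    refine mul_le_mul_of_nonneg_left ((abs_abs_sub_abs_le _ _).trans (le_of_eq ?_)) hu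
    rw [abs_sub_comm]; congr 1; ring
  cases a with
  | none =>
    have : score u ℓ h y' (none : Outcome J) - score u ℓ h y (none : Outcome J)
        = u * |y - h| - u * |y' - h| := by simp only [score]; ring
    rw [this]; exact key h
  | some i =>
    have : score u ℓ h y' (some i) - score u ℓ h y (some i)
        = u * |y - (i : ℝ) / J| - u * |y' - (i : ℝ) / J| := by simp only [score]; ring
    rw [this]; exact key _

lemma expKernel_le {J : ℕ} {u : ℝ} (hu : 0 ≤ u) (ℓ h : ℝ) {y y' r : ℝ} (hr : |y' - y| ≤ r)
    (a : Outcome J) : expKernel u ℓ h y' a ≤ Real.exp (2 * u * r) * expKernel u ℓ h y a := by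
  have hs : ∀ b : Outcome J, |score u ℓ h y' b - score u ℓ h y b| ≤ u * r := fun b =>
    (abs_score_sub_le hu ℓ h y y' b).trans (by gcongr)
  have h1 : Real.exp (score u ℓ h y' a) ≤ Real.exp (u * r) * Real.exp (score u ℓ h y a) := by
    rw [← Real.exp_add, Real.exp_le_exp]
    linarith [(abs_le.1 (hs a)).2]
  have h2 : ∑ b : Outcome J, Real.exp (score u ℓ h y b)
      ≤ Real.exp (u * r) * ∑ b : Outcome J, Real.exp (score u ℓ h y' b) := by
    rw [Finset.mul_sum]
    refine Finset.sum_le_sum fun b _ => ?_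
    rw [← Real.exp_add, Real.exp_le_exp]
    linarith [(abs_le.1 (hs b)).1]
  have hZ := sum_exp_pos (score (J := J) u ℓ h y)
  have hZ' := sum_exp_pos (score (J := J) u ℓ h y')
  rw [expKernel, expKernel, mul_div_assoc', div_le_div_iff₀ hZ' hZ]
  have e : Real.exp (2 * u * r) = Real.exp (u * r) * Real.exp (u * r) := by
    rw [← Real.exp_add]; congr 1; ring
  calc _ ≤ (Real.exp (u * r) * Real.exp (score u ℓ h y a)) *
        (Real.exp (u * r) * ∑ b : Outcome J, Real.exp (score u ℓ h y' b)) := by gcongr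
    _ = _ := by rw [e]; ring

/-- The exponential mechanism is stable under small changes of the empirical mean. -/
lemma abs_expKernel_sub_le {J : ℕ} {u : ℝ} (hu : 0 ≤ u) (ℓ h : ℝ) {y y' r : ℝ}
    (hr : |y' - y| ≤ r) (hur : 2 * u * r ≤ 1) (a : Outcome J) :
    |expKernel u ℓ h y' a - expKernel u ℓ h y a| ≤ 4 * u * r * expKernel u ℓ h y a := by
  have hr0 : 0 ≤ r := (abs_nonneg _).trans hr
  have hx0 : 0 ≤ 2 * u * r := by positivity
  have h1 := expKernel_le hu ℓ h hr a
  have h2 := expKernel_le hu ℓ h ((abs_sub_comm y y').trans_le hr) a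
  have hp := expKernel_pos u ℓ h y a
  have hp' := expKernel_pos u ℓ h y' a
  have h3 := Real.abs_exp_sub_one_le (x := 2 * u * r) (by rwa [abs_of_nonneg hx0])
  rw [abs_of_nonneg hx0] at h3
  have h4 := (abs_le.1 h3).2
  rw [abs_le]
  constructor
  · have h5 : Real.exp (-(2 * u * r)) * expKernel u ℓ h y a ≤ expKernel u ℓ h y' a := by
      rw [Real.exp_neg, inv_mul_le_iff₀ (Real.exp_pos _)]; exact h2
    have h6 := Real.add_one_le_exp (-(2 * u * r))
    nlinarith
  · nlinarith

/-- The exponential mechanism rarely yields an outcome that is not good. -/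
lemma sum_expKernel_not_good_le {J : ℕ} {α ℓ h y : ℝ} (hα : 0 < α) (hα1 : α < 1)
    (hJ1 : 16 / α ≤ J) (hJ2 : (J : ℝ) ≤ 32 / α) (hℓ : 4 ≤ ℓ) (hy : y ∈ Set.Icc (0 : ℝ) 1)
    [DecidablePred (IsGoodOutcome (J := J) α h y)] :
    ∑ a : Outcome J, (if IsGoodOutcome α h y a then 0 else expKernel (16 * ℓ / α) ℓ h y a)
      ≤ 5 * Real.exp (-ℓ) := by
  have hJ' : (0 : ℝ) < J := lt_of_lt_of_le (by positivity) hJ1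
  have hJ : 1 ≤ J := by exact_mod_cast hJ'
  set u := 16 * ℓ / α with hu
  have hu0 : 0 ≤ u := by positivity
  have huα : u * α = 16 * ℓ := by rw [hu]; field_simp
  set Z := ∑ b : Outcome J, Real.exp (score u ℓ h y b) with hZ
  have hZ0 : 0 < Z := sum_exp_pos _
  have hZge : ∀ b : Outcome J, Real.exp (score u ℓ h y b) ≤ Z := fun b =>
    Finset.single_le_sum (f := fun b => Real.exp (score u ℓ h y b))
      (fun _ _ => (Real.exp_pos _).le) (Finset.mem_univ b)
  -- the nearest grid point already contributes `exp (-ℓ)` to the normalization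
  have hZ1 : Real.exp (-ℓ) ≤ Z := by
    obtain ⟨i, hi⟩ := exists_abs_sub_div_le hJ hy
    refine le_trans ?_ (hZge (some i))
    rw [Real.exp_le_exp, score, neg_le_neg_iff]
    have h1 : (1 : ℝ) / J ≤ α / 16 := by
      rw [div_le_div_iff₀ hJ' (by norm_num)]
      rw [div_le_iff₀ hα] at hJ1
      linarith
    nlinarith
  have hnone : (if IsGoodOutcome α h y (none : Outcome J) then 0 else
      Real.exp (score u ℓ h y (none : Outcome J))) ≤ Real.exp (-ℓ) * Z := by
    split_ifs with hg
    · positivity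
    · have hg' : α / 2 < |y - h| := not_le.1 hg
      calc Real.exp (score u ℓ h y (none : Outcome J)) ≤ Real.exp (-ℓ + -ℓ) := by
            rw [Real.exp_le_exp, score]; nlinarith
        _ = Real.exp (-ℓ) * Real.exp (-ℓ) := Real.exp_add _ _
        _ ≤ _ := by gcongr
  have hsome : ∀ i : Fin (J + 1), (if IsGoodOutcome α h y (some i : Outcome J) then 0 else
      Real.exp (score u ℓ h y (some i : Outcome J)))
      ≤ Real.exp (-ℓ) * Z * Real.exp (-(u / 2 * |y - (i : ℝ) / J|)) := by
    intro i
    split_ifs with hg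
    · positivity
    · set t := |y - (i : ℝ) / J| with ht
      have ht0 : 0 ≤ t := abs_nonneg _
      have hg' : α / 4 < t ∨ |y - h| < 5 * α / 16 := by
        by_contra! hcon
        exact hg hcon
      rw [score, ← ht]
      rcases hg' with h1 | h1
      · calc Real.exp (-(u * t)) ≤ Real.exp (-ℓ + -ℓ + -(u / 2 * t)) := by
              rw [Real.exp_le_exp]; nlinarith
          _ = Real.exp (-ℓ) * Real.exp (-ℓ) * Real.exp (-(u / 2 * t)) := by
              rw [Real.exp_add, Real.exp_add]
          _ ≤ _ := by gcongr
      · have h2 : Real.exp ℓ ≤ Z := by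
          refine le_trans ?_ (hZge none)
          rw [Real.exp_le_exp, score]; nlinarith
        calc Real.exp (-(u * t)) ≤ Real.exp (-(u / 2 * t)) := by
              rw [Real.exp_le_exp]; nlinarith
          _ = Real.exp (-ℓ) * Real.exp ℓ * Real.exp (-(u / 2 * t)) := by
              rw [← Real.exp_add]; simp
          _ ≤ _ := by gcongr
  have hgrid : ∑ i : Fin (J + 1), Real.exp (-(u / 2 * |y - (i : ℝ) / J|)) ≤ 4 := by
    refine sum_exp_neg_abs_sub_le hJ (hJ2.trans ?_) hy.1
    rw [hu, div_div, div_le_div_iff₀ hα (by positivity)]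
    nlinarith
  have hEq : ∀ a : Outcome J, (if IsGoodOutcome α h y a then 0 else expKernel u ℓ h y a)
      = (if IsGoodOutcome α h y a then 0 else Real.exp (score u ℓ h y a)) / Z := by
    intro a
    split_ifs
    · simp
    · rfl
  simp only [hEq]
  rw [← Finset.sum_div, div_le_iff₀ hZ0, Fintype.sum_option]
  have h1 := Finset.sum_le_sum fun i (_ : i ∈ Finset.univ) => hsome i
  rw [← Finset.mul_sum] at h1
  have h2 := mul_le_mul_of_nonneg_left hgrid (by positivity : 0 ≤ Real.exp (-ℓ) * Z)
  linarith

/-- Conditioning on a likely event yields a law supported on the event and dominated by the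
original one. -/
lemma exists_PMF_supported_le {ι : Type*} [Fintype ι] {P : ι → ℝ} (hP : ∀ a, 0 ≤ P a)
    (hP1 : ∑ a, P a = 1) (E : ι → Prop) [DecidablePred E] {ε r : ℝ}
    (hE : ∑ a, (if E a then 0 else P a) ≤ ε) (hr : 0 ≤ r) (hrε : 1 ≤ (1 + r) * (1 - ε)) :
    ∃ μ : PMF ι, (∀ a, μ a ≠ 0 → E a) ∧ ∀ a, μ a ≤ ENNReal.ofReal ((1 + r) * P a) := by
  set G := ∑ a, (if E a then P a else 0) with hG
  have hGε : 1 - ε ≤ G := by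
    have : G + ∑ a, (if E a then 0 else P a) = 1 := by
      rw [hG, ← Finset.sum_add_distrib, ← hP1]
      exact Finset.sum_congr rfl fun a _ => by split_ifs <;> simp
    linarith
  have hG1 : 1 ≤ (1 + r) * G := hrε.trans (by gcongr)
  have hG0 : 0 < G := by
    by_contra! hcon
    nlinarith
  have hnn : ∀ a, 0 ≤ (if E a then P a else 0) / G := fun a =>
    div_nonneg (by split_ifs <;> simp [hP]) hG0.le
  refine ⟨PMF.ofFintype (fun a => ENNReal.ofReal ((if E a then P a else 0) / G)) ?_, ?_, ?_⟩
  · rw [← ENNReal.ofReal_sum_of_nonneg fun a _ => hnn a, ← Finset.sum_div, ← hG,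
      div_self hG0.ne', ENNReal.ofReal_one]
  · intro a ha
    by_contra hEa
    simp [hEa] at ha
  · intro a
    rw [PMF.ofFintype_apply]
    refine ENNReal.ofReal_le_ofReal ?_
    rw [div_le_iff₀ hG0]
    split_ifs
    · nlinarith [hP a]
    · have := hP a
      positivity

/-- A kernel ignoring the sample, which keeps the hypothesis with probability `m / (m + 1)`. -/
def constKernel {J : ℕ} (m : ℕ) : Outcome J → ℝ
  | none => m / (m + 1)
  | some _ => 1 / ((m + 1) * (J + 1))

lemma constKernel_pos {J m : ℕ} (hm : 1 ≤ m) (a : Outcome J) : 0 < constKernel m a := by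
  have : (0 : ℝ) < m := by exact_mod_cast hm
  cases a <;> simp only [constKernel] <;> positivity

lemma sum_constKernel (J m : ℕ) : ∑ a : Outcome J, constKernel m a = 1 := by
  rw [Fintype.sum_option]
  simp only [constKernel, Finset.sum_const, Finset.card_univ, Fintype.card_fin, nsmul_eq_mul]
  push_cast
  field_simp

lemma exists_isGoodOutcome {J : ℕ} {α h y : ℝ} (hα : 0 < α) (hJ1 : 16 / α ≤ J)
    (hy : y ∈ Set.Icc (0 : ℝ) 1) : ∃ a : Outcome J, IsGoodOutcome α h y a := by
  have hJ' : (0 : ℝ) < J := lt_of_lt_of_le (by positivity) hJ1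
  rcases le_or_gt (|y - h|) (α / 2) with h1 | h1
  · exact ⟨none, h1⟩
  · obtain ⟨i, hi⟩ := exists_abs_sub_div_le (J := J) (by exact_mod_cast hJ') hy
    refine ⟨some i, hi.trans ?_, by linarith⟩
    rw [div_le_div_iff₀ hJ' (by norm_num)]
    rw [div_le_iff₀ hα] at hJ1
    linarith

/-- The regime of differential privacy: conditioned on good outcomes, the exponential mechanism
answers the queries with a sample size proportional to the square root of the bound `T` on the
number of updates. -/
theorem exists_isAccurate_of_stability {X : Type u} [Fintype X] {n m : ℕ} {α β B T : ℝ}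
    (hα : 0 < α) (hα1 : α < 1) (hβ : 0 ≤ β) (hm : 1 ≤ m) (hB : 1 ≤ B) (hBT : B ≤ T)
    (hT : 1024 / (25 * α ^ 2) * Real.log (Fintype.card X) ≤ T)
    (hn : 528 * B / α ^ 2 ≤ n)
    (hn' : 16896 * Real.sqrt (B * T) * Real.log (100 * m) / α ^ 2 ≤ n)
    (hβB : 6 * Real.exp (-(2 * B)) ≤ β) : ∃ A : Algorithm X n, IsAccurate A α β m := by
  classical
  have hm' : (1 : ℝ) ≤ m := by exact_mod_cast hm
  have hm0 : (0 : ℝ) < m := by linarith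
  have hT0 : 0 < T := by linarith
  have hn0 : (0 : ℝ) < n := lt_of_lt_of_le (by positivity) hn
  set ℓ := Real.log (100 * m) with hℓ
  have hℓ4 : 4 ≤ ℓ := by
    rw [hℓ, Real.le_log_iff_exp_le (by positivity)]
    have h1 : Real.exp 4 = Real.exp 1 ^ 4 := by rw [← Real.exp_nat_mul]; norm_num
    have h2 := Real.exp_one_lt_d9
    have h3 : Real.exp 1 ^ 4 ≤ 3 ^ 4 := by
      have := Real.exp_pos 1
      gcongr
      linarith
    rw [h1]
    linarith
  have hexpℓ : Real.exp (-ℓ) = 1 / (100 * m) := by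
    rw [hℓ, Real.exp_neg, Real.exp_log (by positivity), one_div]
  set J := ⌈16 / α⌉₊ with hJ
  have hJ1 : 16 / α ≤ J := Nat.le_ceil _
  have hJ2 : (J : ℝ) ≤ 32 / α := by
    have h1 := (Nat.ceil_lt_add_one (a := 16 / α) (by positivity)).le
    have h2 : 1 ≤ 16 / α := by rw [one_le_div hα]; linarith
    have h3 : 32 / α = 16 / α + 16 / α := by ring
    rw [h3]; exact h1.trans (by linarith)
  set u := 16 * ℓ / α with hu
  have hu0 : 0 ≤ u := by positivity
  set s := Real.sqrt (B * T) with hs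
  have hs2 : s ^ 2 = B * T := Real.sq_sqrt (by positivity)
  have hs0 : 0 < s := Real.sqrt_pos.2 (by positivity)
  have hBs : B ≤ s := Real.le_sqrt_of_sq_le (by nlinarith)
  set δ := 4 * u * (1 / (n : ℝ)) with hδ
  have hδ0 : 0 ≤ δ := by positivity
  have hδs : 66 * B / α * δ ≤ B / (4 * s) := by
    have e : 66 * B / α * δ = B * (4224 * ℓ / α ^ 2) / n := by
      rw [hδ, hu]; field_simp; ring
    rw [e, div_le_div_iff₀ hn0 (by positivity)]
    have : 4224 * ℓ / α ^ 2 * (4 * s) ≤ n := le_trans (le_of_eq (by ring)) hn'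
    calc B * (4224 * ℓ / α ^ 2) * (4 * s) = B * (4224 * ℓ / α ^ 2 * (4 * s)) := by ring
      _ ≤ _ := by gcongr
  have hδ4 : 66 * B / α * δ ≤ 1 / 4 := by
    refine hδs.trans ?_
    rw [div_le_div_iff₀ (by positivity) (by norm_num)]
    linarith
  have hur : 2 * u * (1 / (n : ℝ)) ≤ 1 := by
    have h1 : 1 ≤ 66 * B / α := by rw [one_le_div hα]; linarith
    have h2 : δ ≤ 66 * B / α * δ := le_mul_of_one_le_left hδ0 h1
    have h3 : 2 * u * (1 / (n : ℝ)) = δ / 2 := by rw [hδ]; ring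
    rw [h3]; linarith
  have hker : ∀ h ∈ Set.Icc (0 : ℝ) 1, ∀ y ∈ Set.Icc (0 : ℝ) 1, ∃ μ : PMF (Outcome J),
      (∀ a, μ a ≠ 0 → IsGoodOutcome α h y a) ∧
        ∀ a, μ a ≤ ENNReal.ofReal ((1 + 1 / (m : ℝ)) * expKernel u ℓ h y a) := by
    intro h _ y hy
    refine exists_PMF_supported_le (fun a => (expKernel_pos u ℓ h y a).le) (sum_expKernel u ℓ h y)
      _ (sum_expKernel_not_good_le hα hα1 hJ1 hJ2 hℓ4 hy) (by positivity) ?_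
    rw [hexpℓ]
    have : (1 + 1 / (m : ℝ)) * (1 - 5 * (1 / (100 * m))) - 1
        = (19 * m - 1) / (20 * m ^ 2) := by field_simp; ring
    have h2 : 0 ≤ (19 * (m : ℝ) - 1) / (20 * m ^ 2) := div_nonneg (by linarith) (by positivity)
    linarith
  choose! κ hκ1 hκ2 using hker
  refine ⟨mwAlgorithm X n κ (5 * α / 32), mwAlgorithm_isAccurate hα hα1 hβ hm
    (fun h hh y hy => hκ1 h hh y hy) (P := expKernel u ℓ) (expKernel_pos u ℓ) (sum_expKernel u ℓ)
    (c := 1) le_rfl ?_ hδ0 (fun h y y' a hyy => abs_expKernel_sub_le hu0 ℓ h hyy hur a) hB hT hδ4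
    ?_ hn ?_⟩
  · intro h hh y hy a
    simpa using hκ2 h hh y hy a
  · have h1 : (66 * B / α * δ) ^ 2 ≤ (B / (4 * s)) ^ 2 := by gcongr
    have h2 : (B / (4 * s)) ^ 2 = B / (16 * T) := by
      rw [div_pow, mul_pow, hs2]; field_simp; norm_num
    rw [h2] at h1
    calc 8 * (66 * B / α * δ) ^ 2 * T ≤ 8 * (B / (16 * T)) * T := by gcongr
      _ = B / 2 := by field_simp; norm_num
      _ ≤ B := by linarith
  · refine le_trans ?_ hβB
    rw [Real.log_one, mul_zero, Real.exp_zero, mul_one]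
    have := Real.exp_one_lt_d9
    have := Real.exp_pos (-(2 * B))
    nlinarith

/-- The regime of description length: a deterministic choice of good outcomes has few updates,
hence few possible outcome sequences. -/
theorem exists_isAccurate_of_description {X : Type u} [Fintype X] {n m : ℕ} {α β B T : ℝ}
    (hα : 0 < α) (hα1 : α < 1) (hβ : 0 ≤ β) (hm : 1 ≤ m) (hB : 1 ≤ B)
    (hT : 1024 / (25 * α ^ 2) * Real.log (Fintype.card X) ≤ T)
    (hn : 528 * (B + T * Real.log (36 * m / α)) / α ^ 2 ≤ n)
    (hβB : 6 * Real.exp (-(2 * B)) ≤ β) : ∃ A : Algorithm X n, IsAccurate A α β m := by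
  classical
  have hm' : (1 : ℝ) ≤ m := by exact_mod_cast hm
  have hm0 : (0 : ℝ) < m := by linarith
  have hT0 : 0 ≤ T := le_trans (mul_nonneg (by positivity) (Real.log_natCast_nonneg _)) hT
  set J := ⌈16 / α⌉₊ with hJ
  have hJ1 : 16 / α ≤ J := Nat.le_ceil _
  have hJ2 : (J : ℝ) + 1 ≤ 18 / α := by
    have h1 := (Nat.ceil_lt_add_one (a := 16 / α) (by positivity)).le
    have h2 : 1 ≤ 1 / α := by rw [one_le_div hα]; linarith
    have h3 : 18 / α = 16 / α + 2 * (1 / α) := by ring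
    rw [h3]; linarith
  set c : ℝ := (m + 1) * (J + 1) with hc
  have hc1 : 1 ≤ c := by
    rw [hc]
    have : (0 : ℝ) ≤ J := by positivity
    nlinarith
  have hc2 : c ≤ 36 * m / α := by
    calc c ≤ (2 * m) * (18 / α) := by rw [hc]; gcongr; linarith
      _ = _ := by ring
  have hlog : Real.log c ≤ Real.log (36 * m / α) := Real.log_le_log (by linarith) hc2
  have hlog0 : 0 ≤ Real.log c := Real.log_nonneg hc1
  have hTl : 0 ≤ T * Real.log c := mul_nonneg hT0 hlog0
  have hker : ∀ h y : ℝ, y ∈ Set.Icc (0 : ℝ) 1 → ∃ a : Outcome J, IsGoodOutcome α h y a :=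
    fun h y hy => exists_isGoodOutcome hα hJ1 hy
  choose! g hg using hker
  refine ⟨mwAlgorithm X n (fun h y => PMF.pure (g h y)) (5 * α / 32),
    mwAlgorithm_isAccurate hα hα1 hβ hm ?_ (P := fun _ _ => constKernel m)
    (fun _ _ => constKernel_pos hm) (fun _ _ => sum_constKernel J m) hc1 ?_ le_rfl ?_
    (B := B + T * Real.log c) (by linarith) hT ?_ ?_ ?_ ?_⟩
  · intro h _ y hy a ha
    have : a = g h y := by
      by_contra hne
      exact ha (by simp [PMF.pure_apply, hne])
    rw [this]
    exact hg h y hy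
  · intro h _ y _ a
    have h1 : 1 ≤ (1 + 1 / (m : ℝ)) * (if a.isSome then c else 1) * constKernel m a := by
      cases a with
      | none =>
        simp only [constKernel, Option.isSome_none, Bool.false_eq_true, if_false]
        refine le_of_eq ?_
        field_simp
      | some i =>
        simp only [constKernel, Option.isSome_some, if_true, hc]
        have : (1 + 1 / (m : ℝ)) * ((m + 1) * (J + 1)) * (1 / ((m + 1) * (J + 1)))
            = 1 + 1 / (m : ℝ) := by field_simp
        rw [this]
        have : 0 < 1 / (m : ℝ) := by positivity
        linarith
    exact (PMF.coe_le_one _ _).trans (by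
      rw [← ENNReal.ofReal_one]; exact ENNReal.ofReal_le_ofReal h1)
  · intro h y y' a _
    simp
  · simp
  · simp only [mul_zero, ne_eq, OfNat.ofNat_ne_zero, not_false_eq_true, zero_pow, zero_mul]
    linarith
  · refine le_trans ?_ hn
    gcongr
  · refine le_trans ?_ hβB
    have e : Real.exp (-(2 * (B + T * Real.log c)))
        = Real.exp (-(2 * B)) * Real.exp (-(T * Real.log c)) * Real.exp (-(T * Real.log c)) := by
      rw [← Real.exp_add, ← Real.exp_add]; congr 1; ring
    have e2 : Real.exp (T * Real.log c) * Real.exp (-(T * Real.log c)) = 1 := by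
      rw [← Real.exp_add]; simp
    rw [e]
    have h1 : Real.exp (-(T * Real.log c)) ≤ 1 := by rw [Real.exp_le_one_iff]; linarith
    have h2 := Real.exp_one_lt_d9
    have h3 := Real.exp_pos (-(2 * B))
    have h4 := Real.exp_pos 1
    calc Real.exp 1 * Real.exp (T * Real.log c) *
          (2 * (Real.exp (-(2 * B)) * Real.exp (-(T * Real.log c)) * Real.exp (-(T * Real.log c))))
        = 2 * Real.exp 1 * Real.exp (-(2 * B)) *
            (Real.exp (T * Real.log c) * Real.exp (-(T * Real.log c))) *
            Real.exp (-(T * Real.log c)) := by ring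
      _ ≤ 2 * Real.exp 1 * Real.exp (-(2 * B)) * 1 := by
          rw [e2, mul_one]
          exact mul_le_of_le_one_right (by positivity) h1
      _ ≤ _ := by nlinarith

/-- The algorithm answering with empirical means. -/
def empiricalAlgorithm (X : Type u) (n : ℕ) : Algorithm X n where
  State := Fin n → X
  init S := PMF.pure S
  step S f := PMF.pure (S, sampleMean S (queryFun f))

/-- A single query may be answered with its empirical mean. -/
theorem empiricalAlgorithm_isAccurate_one {X : Type u} [Fintype X] {n : ℕ} {α β B : ℝ}
    (hα : 0 < α) (hα1 : α < 1) (hβ : 0 ≤ β) (hB : 1 ≤ B) (hn : 528 * B / α ^ 2 ≤ n)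
    (hβB : 6 * Real.exp (-(2 * B)) ≤ β) : IsAccurate (empiricalAlgorithm X n) α β 1 := by
  classical
  intro D Adv
  refine le_toReal_toOuterMeasure_of_compl _ _ hβ ?_
  set d : X → ℝ := fun x => (D x).toReal with hd
  have hd0 : ∀ x, 0 ≤ d x := fun x => ENNReal.toReal_nonneg
  have hd1 : ∑ x, d x = 1 := PMF_sum_toReal D
  have hn0 : (0 : ℝ) < n := lt_of_lt_of_le (by positivity) hn
  -- the probability that the empirical mean of `g` is too large by `α`
  have tail : ∀ g : X → ℝ, (∀ x, 0 ≤ g x) → (∀ x, g x ≤ 1) →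
      ∑ S : Fin n → X, sampleWeight d S *
        (if α ≤ sampleMean S g - weightedMean d g then (1 : ℝ) else 0)
        ≤ 2 * Real.exp (-(2 * B)) := by
    intro g hg0 hg1
    set p := ⌈32 * B / α⌉₊ with hp
    have hp1 : 32 * B / α ≤ p := Nat.le_ceil _
    have hp2 : (p : ℝ) ≤ 33 * B / α := by
      have h1 := (Nat.ceil_lt_add_one (a := 32 * B / α) (by positivity)).le
      have h2 : 1 ≤ B / α := by rw [one_le_div (by positivity)]; linarith
      have h3 : 33 * B / α = 32 * B / α + B / α := by ring
      rw [h3]; exact h1.trans (by linarith)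
    have := tail_le_two_mul_exp hd0 hd1 (Finset.univ : Finset Unit) (fun (_ : Fin n → X) _ => 1)
      (fun _ _ => one_pos) (fun _ => by simp) (fun _ => g) (fun _ => hg0) (fun _ => hg1)
      hB hα hα1.le hp1 hp2
      (le_trans (by gcongr; norm_num) hn) (fun _ _ _ => by simp; linarith)
    simpa using this
  have hf : ∀ f : LinearQuery X, ∑ S : Fin n → X, iidSample n D S *
      (if α < |sampleMean S (queryFun f) - populationValue D f| then 1 else 0)
      ≤ ENNReal.ofReal β := by
    intro f
    have hpop : populationValue D f = weightedMean d (queryFun f) := rfl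
    have hw := sampleWeight_nonneg hd0 (n := n)
    have h1 := tail (queryFun f) (queryFun_nonneg f) (queryFun_le_one f)
    have h2 := tail (fun x => 1 - queryFun f x) (fun x => by linarith [queryFun_le_one f x])
      (fun x => by linarith [queryFun_nonneg f x])
    have e1 : ∀ S : Fin n → X, sampleMean S (fun x => 1 - queryFun f x)
        = 1 - sampleMean S (queryFun f) := fun S => by
      simp [sampleMean, Finset.sum_sub_distrib]; field_simp
    have e2 : weightedMean d (fun x => 1 - queryFun f x) = 1 - weightedMean d (queryFun f) := by
      simp [weightedMean, mul_sub, Finset.sum_sub_distrib, hd1]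
    simp only [e1, e2] at h2
    calc ∑ S : Fin n → X, iidSample n D S *
          (if α < |sampleMean S (queryFun f) - populationValue D f| then 1 else 0)
        = ENNReal.ofReal (∑ S : Fin n → X, sampleWeight d S *
          (if α < |sampleMean S (queryFun f) - populationValue D f| then (1 : ℝ) else 0)) := by
          rw [ENNReal.ofReal_sum_of_nonneg fun S _ =>
            mul_nonneg (hw S) (by split_ifs <;> norm_num)]
          refine Finset.sum_congr rfl fun S _ => ?_
          rw [iidSample_apply, ENNReal.ofReal_mul (hw S)]
          split_ifs <;> simp [hd]
      _ ≤ ENNReal.ofReal β := by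
          refine ENNReal.ofReal_le_ofReal (le_trans ?_ hβB)
          have h3 : ∑ S : Fin n → X, sampleWeight d S *
              (if α < |sampleMean S (queryFun f) - populationValue D f| then (1 : ℝ) else 0)
              ≤ 2 * Real.exp (-(2 * B)) + 2 * Real.exp (-(2 * B)) := by
            refine le_trans ?_ (add_le_add h1 h2)
            rw [← Finset.sum_add_distrib]
            refine Finset.sum_le_sum fun S _ => ?_
            rw [← mul_add]
            refine mul_le_mul_of_nonneg_left ?_ (hw S)
            rw [hpop]
            by_cases hlt : α < |sampleMean S (queryFun f) - weightedMean d (queryFun f)|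
            · rw [if_pos hlt]
              rcases lt_abs.1 hlt with h4 | h4
              · rw [if_pos h4.le]
                split_ifs <;> norm_num
              · rw [if_pos (by linarith : α ≤ 1 - sampleMean S (queryFun f)
                  - (1 - weightedMean d (queryFun f)))]
                split_ifs <;> norm_num
            · rw [if_neg hlt]
              split_ifs <;> norm_num
          have := Real.exp_pos (-(2 * B))
          linarith
  have hexp : (experiment (empiricalAlgorithm X n) Adv D 1).toOuterMeasure
      (accurateTranscripts D α)ᶜ = ∑' f, Adv [] f * ∑ S : Fin n → X, iidSample n D S *
      (if α < |sampleMean S (queryFun f) - populationValue D f| then 1 else 0) := by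
    have h1 : experiment (empiricalAlgorithm X n) Adv D 1
        = (iidSample n D).bind fun S => (Adv []).bind fun f =>
            PMF.pure [(f, sampleMean S (queryFun f))] := by
      unfold experiment
      congr 1
      funext S
      refine (PMF.pure_bind _ _).trans ?_
      change ((Adv []).bind fun f => (PMF.pure (S, sampleMean S (queryFun f))).bind fun r =>
        PMF.pure [(f, r.2)]) = _
      simp only [PMF.pure_bind]
    rw [h1, PMF.toOuterMeasure_bind_apply, tsum_fintype]
    simp only [PMF.toOuterMeasure_bind_apply, PMF.toOuterMeasure_pure_apply]
    simp only [← ENNReal.tsum_mul_left, Finset.mul_sum]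
    rw [← Summable.tsum_finsetSum fun _ _ => ENNReal.summable]
    refine tsum_congr fun f => Finset.sum_congr rfl fun S _ => ?_
    simp only [accurateTranscripts, Set.mem_compl_iff, Set.mem_ofPred_eq, List.mem_singleton,
      forall_eq, not_le]
    ring
  rw [hexp]
  calc _ ≤ ∑' f, Adv [] f * ENNReal.ofReal β :=
        ENNReal.tsum_le_tsum fun f => mul_le_mul_right (hf f) _
    _ = ENNReal.ofReal β := by rw [ENNReal.tsum_mul_right, PMF.tsum_coe, one_mul]

/-! ### Sample sizes -/

/-- The sample size in the regime `B ≤ T`. -/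
lemma exists_isAccurate_of_le {X : Type u} [Fintype X] {m : ℕ} {α β B T : ℝ}
    (hα : 0 < α) (hα1 : α < 1) (hβ : 0 ≤ β) (hm : 2 ≤ m) (hB : 1 ≤ B) (hBT : B ≤ T)
    (hT : 1024 / (25 * α ^ 2) * Real.log (Fintype.card X) ≤ T)
    (hβB : 6 * Real.exp (-(2 * B)) ≤ β) :
    ∃ n : ℕ, (n : ℝ) ≤ 16896 * 8 * (Real.sqrt (B * T) / α ^ 2) * Real.log m
        + 529 * (B / α ^ 2) ∧ ∃ A : Algorithm X n, IsAccurate A α β m := by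
  have hm' : (2 : ℝ) ≤ m := by exact_mod_cast hm
  set ℓ := Real.log (100 * m) with hℓ
  have hℓ8 : ℓ ≤ 8 * Real.log m := by
    have h1 : (100 : ℝ) * m ≤ m ^ 8 := by
      have h2 : (2 : ℝ) ^ 7 ≤ m ^ 7 := by gcongr
      calc (100 : ℝ) * m ≤ m ^ 7 * m := by gcongr; linarith
        _ = m ^ 8 := by ring
    calc ℓ ≤ Real.log ((m : ℝ) ^ 8) := Real.log_le_log (by positivity) h1
      _ = 8 * Real.log m := by rw [Real.log_pow]; norm_num
  have hℓ0 : 0 ≤ ℓ := Real.log_nonneg (by linarith)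
  set s := Real.sqrt (B * T) with hs
  have hs0 : 0 ≤ s := Real.sqrt_nonneg _
  set r := 16896 * s * ℓ / α ^ 2 + 528 * B / α ^ 2 with hr
  have hr1 : 0 ≤ 16896 * s * ℓ / α ^ 2 := by positivity
  have hr2 : 0 ≤ 528 * B / α ^ 2 := by positivity
  have hrn : r ≤ ⌈r⌉₊ := Nat.le_ceil _
  refine ⟨⌈r⌉₊, ?_, exists_isAccurate_of_stability hα hα1 hβ (by omega) hB hBT hT (by linarith)
    (by linarith) hβB⟩
  have h1 := (Nat.ceil_lt_add_one (a := r) (by linarith)).le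
  have hα2 : α ^ 2 ≤ 1 := pow_le_one₀ hα.le hα1.le
  have hBα1 : 1 ≤ B / α ^ 2 := by rw [one_le_div (by positivity)]; linarith
  have h2 : 16896 * s * ℓ / α ^ 2 ≤ 16896 * 8 * (s / α ^ 2) * Real.log m := by
    calc 16896 * s * ℓ / α ^ 2 = 16896 * (s / α ^ 2) * ℓ := by ring
      _ ≤ 16896 * (s / α ^ 2) * (8 * Real.log m) := by gcongr
      _ = _ := by ring
  have h3 : 528 * B / α ^ 2 = 528 * (B / α ^ 2) := by ring
  linarith

/-- The sample size in the regime `T < B`. If there are updates at all, then `1 / α` is polynomial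
in `m`, since `1 / α ^ 2` is at most of the order of `T < B ≤ Γ * m`. -/
lemma exists_isAccurate_of_lt {X : Type u} [Fintype X] {m : ℕ} {α β B T Γ : ℝ}
    (hα : 0 < α) (hα1 : α < 1) (hβ : 0 ≤ β) (hm : 2 ≤ m) (hB : 1 ≤ B) (hBT : T < B)
    (hT : T = 41 * Real.log (Fintype.card X) / α ^ 2)
    (hΓ : 1 ≤ Γ) (hBm : B ≤ Γ * m)
    (hβB : 6 * Real.exp (-(2 * B)) ≤ β) :
    ∃ n : ℕ, (n : ℝ) ≤ 528 * 74 * Γ * (T / α ^ 2) * Real.log m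
        + 529 * (B / α ^ 2) ∧ ∃ A : Algorithm X n, IsAccurate A α β m := by
  have hm' : (2 : ℝ) ≤ m := by exact_mod_cast hm
  have hlog2 := Real.log_two_gt_d9
  have hlm : 1 / 2 ≤ Real.log m := by
    have := Real.log_le_log (by norm_num) hm'
    linarith
  set L := Real.log (Fintype.card X : ℝ) with hL
  have hL0 : 0 ≤ L := Real.log_natCast_nonneg _
  have hT0 : 0 ≤ T := by rw [hT]; positivity
  have hTL : 1024 / (25 * α ^ 2) * L ≤ T := by
    have : 1024 / (25 * α ^ 2) * L = 1024 / 25 * (L / α ^ 2) := by field_simp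
    rw [this, hT, mul_div_assoc]
    gcongr
    norm_num
  set ℓ := Real.log (36 * m / α) with hℓ
  have hℓ0 : 0 ≤ ℓ := by
    refine Real.log_nonneg ?_
    rw [one_le_div hα]; linarith
  have hTℓ : T * ℓ ≤ T * (74 * Γ * Real.log m) := by
    rcases le_or_gt (Fintype.card X) 1 with hX | hX
    · have : L = 0 := by
        rw [hL]
        interval_cases (Fintype.card X) <;> simp
      simp [hT, this]
    · have hX2 : (2 : ℝ) ≤ Fintype.card X := by exact_mod_cast hX
      have hL1 : 1 / 2 ≤ L := by
        have := Real.log_le_log (by norm_num) hX2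
        linarith
      refine mul_le_mul_of_nonneg_left ?_ hT0
      have h1 : 1 / α ^ 2 ≤ Γ * m := by
        have e : T = 41 * L * (1 / α ^ 2) := by rw [hT]; ring
        have h3 : 0 < 1 / α ^ 2 := by positivity
        nlinarith
      have h2 : 1 / α ≤ 1 / α ^ 2 := by
        apply one_div_le_one_div_of_le (by positivity)
        nlinarith
      have h3 : 36 * m / α ≤ 36 * Γ * (m : ℝ) ^ 2 := by
        calc 36 * m / α = 36 * m * (1 / α) := by ring
          _ ≤ 36 * m * (Γ * m) := by gcongr; linarith
          _ = _ := by ring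
      have h4 : ℓ ≤ Real.log (36 * Γ) + 2 * Real.log m := by
        calc ℓ ≤ Real.log (36 * Γ * (m : ℝ) ^ 2) := Real.log_le_log (by positivity) h3
          _ = _ := by
            rw [Real.log_mul (by positivity) (by positivity), Real.log_pow]; norm_num
      have h5 := Real.log_le_sub_one_of_pos (show 0 < 36 * Γ by positivity)
      nlinarith
  set r := 528 * (B + T * ℓ) / α ^ 2 with hr
  have hr0 : 0 ≤ r := by positivity
  refine ⟨⌈r⌉₊, ?_, exists_isAccurate_of_description hα hα1 hβ (by omega) hB hTL (Nat.le_ceil _)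
    hβB⟩
  have h1 := (Nat.ceil_lt_add_one (a := r) hr0).le
  have hα2 : α ^ 2 ≤ 1 := pow_le_one₀ hα.le hα1.le
  have hBα1 : 1 ≤ B / α ^ 2 := by rw [one_le_div (by positivity)]; linarith
  have h2 : r ≤ 528 * (B / α ^ 2) + 528 * 74 * Γ * (T / α ^ 2) * Real.log m := by
    calc r ≤ 528 * (B + T * (74 * Γ * Real.log m)) / α ^ 2 := by rw [hr]; gcongr
      _ = _ := by ring
  linarith

lemma six_mul_exp_neg_le {b B : ℝ} (hb : 0 ≤ b) (hB : b + 3 ≤ B) :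
    6 * Real.exp (-(2 * B)) ≤ Real.exp (-b) := by
  have h1 : Real.exp (-(2 * B)) ≤ Real.exp (-6) * Real.exp (-b) := by
    rw [← Real.exp_add, Real.exp_le_exp]; linarith
  have h2 : 6 * Real.exp (-6) ≤ 1 := by
    have := Real.add_one_le_exp (6 : ℝ)
    rw [Real.exp_neg, ← div_eq_mul_inv, div_le_one (Real.exp_pos _)]
    linarith
  calc 6 * Real.exp (-(2 * B)) ≤ 6 * (Real.exp (-6) * Real.exp (-b)) := by gcongr
    _ = 6 * Real.exp (-6) * Real.exp (-b) := by ring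
    _ ≤ Real.exp (-b) := mul_le_of_le_one_left (Real.exp_pos _).le h2

/-- Both regimes are covered by the minimum in the claimed sample size. -/
lemma div_sq_le_mul_min {α Γ L b t : ℝ} (hα : 0 < α) (hΓ : 1 ≤ Γ) (hL : 0 ≤ L) (hb : 0 ≤ b)
    (h1 : t ≤ Real.sqrt (Γ * b * (41 * L / α ^ 2))) (h2 : t ≤ 41 * L / α ^ 2) :
    t / α ^ 2 ≤ 41 * Γ * min (Real.sqrt (L * b) / α ^ 3) (L / α ^ 4) := by
  have hs : Real.sqrt (Γ * b * (41 * L / α ^ 2)) ≤ 41 * Γ * Real.sqrt (L * b) / α := by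
    rw [Real.sqrt_le_iff]
    refine ⟨by positivity, ?_⟩
    rw [div_pow, mul_pow, Real.sq_sqrt (by positivity)]
    have : Γ * b * (41 * L / α ^ 2) = (41 * Γ) * (L * b) / α ^ 2 := by ring
    rw [this]
    gcongr
    nlinarith
  rw [mul_min_of_nonneg _ _ (by positivity)]
  refine le_min ?_ ?_
  · calc t / α ^ 2 ≤ (41 * Γ * Real.sqrt (L * b) / α) / α ^ 2 := by gcongr; exact h1.trans hs
      _ = _ := by field_simp
  · calc t / α ^ 2 ≤ (41 * L / α ^ 2) / α ^ 2 := by gcongr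
      _ = 41 * 1 * (L / α ^ 4) := by field_simp
      _ ≤ _ := by gcongr

end AdaptiveDataAnalysis

end

theorem theorem9 (β₀ : ℝ) (hβ₀ : β₀ < 1) :
    ∃ C : ℝ, 0 < C ∧
      ∀ (X : Type u) [Fintype X] (m : ℕ) (α β : ℝ),
        1 ≤ m → 0 < α → α < 1 → ((2 : ℝ) ^ m)⁻¹ ≤ β → β ≤ β₀ →
        ∃ n : ℕ,
          (n : ℝ) ≤ C *
            (min (Real.sqrt (Real.log (Fintype.card X) * Real.log (1 / β)) / α ^ 3)
                (Real.log (Fintype.card X) / α ^ 4) * Real.log m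
              + Real.log (1 / β) / α ^ 2) ∧
          ∃ A : AdaptiveDataAnalysis.Algorithm X n,
            AdaptiveDataAnalysis.IsAccurate A α β m := by
  rcases le_or_gt β₀ 0 with hβ₀0 | hβ₀0
  · refine ⟨1, one_pos, fun X _ m α β _ _ _ h1 h2 => ?_⟩
    have : (0 : ℝ) < ((2 : ℝ) ^ m)⁻¹ := by positivity
    linarith
  set b₀ := Real.log (1 / β₀) with hb₀
  have hb₀0 : 0 < b₀ := Real.log_pos (by rw [lt_div_iff₀ hβ₀0]; linarith)
  -- with `B = Γ * log (1 / β)`, the constant factors in the failure probability are absorbed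
  set Γ := 1 + 3 / b₀ with hΓ
  have hΓ1 : 1 ≤ Γ := by rw [hΓ]; linarith [show 0 < 3 / b₀ by positivity]
  have hΓ2 : Γ ≤ Γ ^ 2 := le_self_pow₀ hΓ1 two_ne_zero
  have hC1 : 16896 * 8 * 41 * Γ ≤ 10000000 * Γ ^ 2 := by linarith
  have hC2 : 528 * 74 * 41 * Γ ^ 2 ≤ 10000000 * Γ ^ 2 := by linarith
  have hC3 : 529 * Γ ≤ 10000000 * Γ ^ 2 := by linarith
  refine ⟨10000000 * Γ ^ 2, by positivity, fun X _ m α β hm hα hα1 hβm hββ₀ => ?_⟩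
  have hβ0 : 0 < β := lt_of_lt_of_le (by positivity) hβm
  set b := Real.log (1 / β) with hb
  set L := Real.log (Fintype.card X : ℝ) with hL
  set R := min (Real.sqrt (L * b) / α ^ 3) (L / α ^ 4) with hR
  have hL0 : 0 ≤ L := Real.log_natCast_nonneg _
  have hbb₀ : b₀ ≤ b := Real.log_le_log (by positivity) (by gcongr)
  have hb0 : 0 < b := by linarith
  have hR0 : 0 ≤ R := le_min (by positivity) (by positivity)
  have hexpb : Real.exp (-b) = β := by
    rw [hb, one_div, Real.log_inv, neg_neg, Real.exp_log hβ0]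
  set B := Γ * b with hB
  have hBb : b + 3 ≤ B := by
    have h1 : 3 ≤ 3 / b₀ * b := by
      rw [div_mul_eq_mul_div, le_div_iff₀ hb₀0]
      linarith
    have h2 : B = b + 3 / b₀ * b := by rw [hB, hΓ]; ring
    linarith
  have hB1 : 1 ≤ B := by linarith
  have hβB := (AdaptiveDataAnalysis.six_mul_exp_neg_le hb0.le hBb).trans_eq hexpb
  have hα2 : α ^ 2 ≤ 1 := pow_le_one₀ hα.le hα1.le
  have hBα1 : 1 ≤ B / α ^ 2 := by rw [one_le_div (by positivity)]; linarith
  have hBα : B / α ^ 2 = Γ * (b / α ^ 2) := by rw [hB]; ring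
  have hbα : 0 < b / α ^ 2 := by positivity
  rcases hm.eq_or_lt with rfl | hm2
  · refine ⟨⌈528 * B / α ^ 2⌉₊, ?_, AdaptiveDataAnalysis.empiricalAlgorithm X _,
      AdaptiveDataAnalysis.empiricalAlgorithm_isAccurate_one hα hα1 hβ0.le hB1 (Nat.le_ceil _) hβB⟩
    have h1 := (Nat.ceil_lt_add_one (a := 528 * B / α ^ 2) (by positivity)).le
    rw [Nat.cast_one, Real.log_one, mul_zero, zero_add]
    calc (⌈528 * B / α ^ 2⌉₊ : ℝ) ≤ 528 * (B / α ^ 2) + 1 := by rw [← mul_div_assoc]; exact h1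
      _ ≤ 528 * (B / α ^ 2) + B / α ^ 2 := by gcongr
      _ = 529 * Γ * (b / α ^ 2) := by rw [hBα]; ring
      _ ≤ _ := mul_le_mul_of_nonneg_right hC3 hbα.le
  have hm2' : (2 : ℝ) ≤ m := by exact_mod_cast hm2
  have hm0 : (0 : ℝ) < m := by linarith
  set lm := Real.log (m : ℝ) with hlm
  have hlm0 : 0 ≤ lm := Real.log_natCast_nonneg _
  -- the number of updates is at most `1024 / 25 * L / α ^ 2`, and `1024 / 25 < 41`
  set T := 41 * L / α ^ 2 with hT
  have hT0 : 0 ≤ T := by positivity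
  have hTL : 1024 / (25 * α ^ 2) * Real.log (Fintype.card X) ≤ T := by
    rw [hT, ← hL, div_mul_eq_mul_div, div_le_div_iff₀ (by positivity) (by positivity)]
    nlinarith [mul_nonneg hL0 (sq_nonneg α)]
  set s := Real.sqrt (B * T) with hs
  have hUR : ∀ t, t ≤ s → t ≤ T → t / α ^ 2 ≤ 41 * Γ * R := fun t h1 h2 =>
    AdaptiveDataAnalysis.div_sq_le_mul_min hα hΓ1 hL0 hb0.le h1 h2
  have hRl : 0 ≤ R * lm := by positivity
  rcases le_or_gt B T with hBT | hBT
  · have hsR := hUR s le_rfl (Real.sqrt_le_iff.2 ⟨hT0, by rw [sq]; gcongr⟩)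
    obtain ⟨n, hn, hA⟩ := AdaptiveDataAnalysis.exists_isAccurate_of_le (X := X) hα hα1 hβ0.le hm2
      hB1 hBT hTL hβB
    refine ⟨n, hn.trans ?_, hA⟩
    rw [hBα]
    calc 16896 * 8 * (s / α ^ 2) * lm + 529 * (Γ * (b / α ^ 2))
        ≤ 16896 * 8 * (41 * Γ * R) * lm + 529 * (Γ * (b / α ^ 2)) := by gcongr
      _ = 16896 * 8 * 41 * Γ * (R * lm) + 529 * Γ * (b / α ^ 2) := by ring
      _ ≤ 10000000 * Γ ^ 2 * (R * lm) + 10000000 * Γ ^ 2 * (b / α ^ 2) := by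
          exact add_le_add (mul_le_mul_of_nonneg_right hC1 hRl)
            (mul_le_mul_of_nonneg_right hC3 hbα.le)
      _ = _ := by ring
  · have hTR := hUR T (Real.le_sqrt_of_sq_le (by rw [sq]; gcongr)) le_rfl
    have hbm : b ≤ m := by
      calc b ≤ Real.log ((2 : ℝ) ^ m) := by
            refine Real.log_le_log (by positivity) ?_
            rw [one_div]
            exact inv_le_of_inv_le₀ (by positivity) hβm
        _ = m * Real.log 2 := Real.log_pow _ _
        _ ≤ m * 1 := by gcongr; exact (Real.log_two_lt_d9.trans (by norm_num)).le
        _ = m := mul_one _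
    obtain ⟨n, hn, hA⟩ := AdaptiveDataAnalysis.exists_isAccurate_of_lt (X := X) hα hα1 hβ0.le hm2
      hB1 hBT hT hΓ1 (by rw [hB]; gcongr) hβB
    refine ⟨n, hn.trans ?_, hA⟩
    rw [hBα]
    calc 528 * 74 * Γ * (T / α ^ 2) * lm + 529 * (Γ * (b / α ^ 2))
        ≤ 528 * 74 * Γ * (41 * Γ * R) * lm + 529 * (Γ * (b / α ^ 2)) := by gcongr
      _ = 528 * 74 * 41 * Γ ^ 2 * (R * lm) + 529 * Γ * (b / α ^ 2) := by ring
      _ ≤ 10000000 * Γ ^ 2 * (R * lm) + 10000000 * Γ ^ 2 * (b / α ^ 2) := by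
          exact add_le_add (mul_le_mul_of_nonneg_right hC2 hRl)
            (mul_le_mul_of_nonneg_right hC3 hbα.le)
      _ = _ := by ring
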